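/- Let $B\subset\mathbb C^2$ be an open Euclidean ball containing the origin, let $\pi:Y\to B$ be the blow-up of $B$ at $0$, i.e. $Y=\{(z,\ell)\in B\times\mathbb P^1: z\in\ell\}$ with $\pi(z,\ell)=z$, and let $E=\pi^{-1}(0)$ be the exceptional divisor. Write $dd^c=\frac{i}{\pi}\partial\bar\partial$. Let $T$ be a positive closed current of bidegree $(1,1)$ on $B$, let $$\nu=\nu(T,0)=\lim_{\rho\to0^+}\frac{1}{\pi\rho^2}\int_{\{|z|<\rho\}}T\wedge\tfrac i2\sum_{j=1}^2dz_j\wedge d\bar z_j$$ be its Lelong number at $0$, and let $R=\pi^*T-\nu[E]$. Here $\pi^*T$ is the current on $Y$ given locally by $dd^c(u\circ\pi)$, where $u$ is a local plurisubharmonic (psh) potential of $T$ (so $T=dd^cu$), and $[E]$ is the current of integration over $E$. Say that a current of bidegree $(1,1)$ on a complex surface $M$ has psh potentials in $W^{1,2}_{loc}(M)$ if every point of $M$ has an open neighbourhood $V$ on which the current equals $dd^cv$ for some psh function $v\in W^{1,2}_{loc}(V)$. If $R$ has psh potentials in $W^{1,2}_{loc}(Y)$, then $T$ has psh potentials in $W^{1,2}_{loc}(B)$;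 moreover, every psh potential of $T$ on an open subset $V\subset B$ belongs to $W^{1,2}_{loc}(V)$. -/

import Mathlib

open MeasureTheory Filter Topology
open scoped ComplexOrder

noncomputable section

namespace BlowDown

/-! ### Complex coordinates, test forms and currents on open subsets of `ℂ²` -/

/-- `ℂ²`, with coordinates `z.1`, `z.2` and Lebesgue measure. -/
abbrev C2 : Type := ℂ × ℂ

/-- The coordinate functions of `ℂ²`, indexed by `Fin 2`. -/
def coord (l : Fin 2) (z : C2) : ℂ := if l = 0 then z.1 else z.2

/-- The standard basis of `ℂ²`. -/
def basisVec (j : Fin 2) : C2 := if j = 0 then (1, 0) else (0, 1)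

/-- The Wirtinger derivative `∂f/∂z_j = (∂f/∂x_j - i ∂f/∂y_j) / 2`. -/
def dz (j : Fin 2) (f : C2 → ℂ) (z : C2) : ℂ :=
  (fderiv ℝ f z (basisVec j) - Complex.I * fderiv ℝ f z (Complex.I • basisVec j)) / 2

/-- The Wirtinger derivative `∂f/∂z̄_k = (∂f/∂x_k + i ∂f/∂y_k) / 2`. -/
def dzbar (k : Fin 2) (f : C2 → ℂ) (z : C2) : ℂ :=
  (fderiv ℝ f z (basisVec k) + Complex.I * fderiv ℝ f z (Complex.I • basisVec k)) / 2

/-- The Euclidean open ball `{z : |z₁ - c₁|² + |z₂ - c₂|² < r²}`. -/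
def euclBall (c : C2) (r : ℝ) : TopologicalSpace.Opens C2 :=
  ⟨{z | ‖z.1 - c.1‖ ^ 2 + ‖z.2 - c.2‖ ^ 2 < r ^ 2}, isOpen_lt (by fun_prop) (by fun_prop)⟩

/-- Smooth compactly supported `(1,1)`-forms on `Ω`, with the usual topology of test functions.
The coefficient matrix `α` stands for the form `∑ j k, α_jk · i dz_j ∧ dz̄_k`. -/
abbrev TestForm (Ω : TopologicalSpace.Opens C2) : Type :=
  TestFunction Ω (Fin 2 → Fin 2 → ℂ) ⊤

/-- Currents of bidegree `(1,1)` on an open subset of `ℂ²`: the continuous linear functionals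
`α ↦ ∫ T ∧ α` on the test forms of bidegree `(1,1)`. -/
abbrev Current (Ω : TopologicalSpace.Opens C2) : Type := TestForm Ω →L[ℂ] ℂ

/-- `T` is positive: `T(α) ≥ 0` for every test form `α` that is positive at every point. -/
def IsPositive {Ω : TopologicalSpace.Opens C2} (T : Current Ω) : Prop :=
  ∀ α : TestForm Ω, (∀ z, (Matrix.of (α z)).PosSemidef) → 0 ≤ (T α).re ∧ (T α).im = 0

/-- `T` is closed: `T` vanishes on `∂γ` for every test form `γ = ∑ γ_k dz̄_k` of bidegree `(0,1)`,
and on `∂̄γ` for every test form `γ = ∑ γ_j dz_j` of bidegree `(1,0)`. (The coefficients below are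
those of `∂γ` and `∂̄γ` up to the constant factors `-i` and `i`.) -/
def IsClosedCurrent {Ω : TopologicalSpace.Opens C2} (T : Current Ω) : Prop :=
  ∀ (γ : TestFunction Ω (Fin 2 → ℂ) ⊤) (α : TestForm Ω),
    ((∀ z j k, α z j k = dz j (fun w => γ w k) z) → T α = 0) ∧
    ((∀ z j k, α z j k = dzbar k (fun w => γ w j) z) → T α = 0)

/-- With `dd^c = (i/π) ∂∂̄`, one has `dd^c α = ddc α dV`, where `dV` is Lebesgue measure.
Here `(i dz_l ∧ dz̄_m) ∧ (i dz_j ∧ dz̄_k) = ε_lj ε_mk · 4 dV`. -/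
def ddc (α : C2 → Fin 2 → Fin 2 → ℂ) (z : C2) : ℂ :=
  ((4 / Real.pi : ℝ) : ℂ) *
    (dz 0 (dzbar 0 fun w => α w 1 1) z - dz 0 (dzbar 1 fun w => α w 1 0) z
      - dz 1 (dzbar 0 fun w => α w 0 1) z + dz 1 (dzbar 1 fun w => α w 0 0) z)

/-- The mass of the trace measure `T ∧ β`, `β = (i/2) ∑ dz_j ∧ dz̄_j`, of a positive current `T` on
the open set `U`: the supremum of `∫ χ T ∧ β` over the test functions `0 ≤ χ ≤ 1` supported
in `U`. -/
def traceMass {Ω : TopologicalSpace.Opens C2} (T : Current Ω) (U : Set C2) : ℝ :=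
  sSup {x : ℝ | ∃ (χ : C2 → ℝ) (α : TestForm Ω), (∀ z, 0 ≤ χ z ∧ χ z ≤ 1) ∧
    (∀ z j k, α z j k = if j = k then ((χ z / 2 : ℝ) : ℂ) else 0) ∧
    tsupport α ⊆ U ∧ x = (T α).re}

/-- The Lelong number `ν(T, a) = lim_{ρ → 0} (T ∧ β)(B(a, ρ)) / (π ρ²)`. -/
def lelongNumber {Ω : TopologicalSpace.Opens C2} (T : Current Ω) (a : C2) : ℝ :=
  limUnder (𝓝[>] (0 : ℝ)) fun ρ => traceMass T (euclBall a ρ) / (Real.pi * ρ ^ 2)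

/-! ### Plurisubharmonic functions, Sobolev functions, potentials -/

/-- `∫₀^{2π} u(a + e^{iθ} b) dθ`, as the difference of the integrals of the positive and of the
negative part. -/
def circleInt (u : C2 → EReal) (a b : C2) : EReal :=
  ((∫⁻ θ in Set.Ioc (0 : ℝ) (2 * Real.pi),
      (u (a + Complex.exp (θ * Complex.I) • b)).toENNReal : ENNReal) : EReal) -
  ((∫⁻ θ in Set.Ioc (0 : ℝ) (2 * Real.pi),
      (-u (a + Complex.exp (θ * Complex.I) • b)).toENNReal : ENNReal) : EReal)

/-- `u : V → [-∞, ∞)` is upper semicontinuous and satisfies the sub-mean value inequality on every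
closed disc contained in `V` in every complex line. -/
def IsPsh (u : C2 → EReal) (V : Set C2) : Prop :=
  (∀ z ∈ V, u z ≠ ⊤) ∧ UpperSemicontinuousOn u V ∧
  ∀ a b : C2, (∀ ζ : ℂ, ‖ζ‖ ≤ 1 → a + ζ • b ∈ V) →
    ((2 * Real.pi : ℝ) : EReal) * u a ≤ circleInt u a b

/-- `u` is a psh potential of `T` on the open set `V`: it is psh, locally integrable (hence not
identically `-∞` on any component) and `dd^c u = T` on `V` in the sense of currents. -/
def IsPshPotential {Ω : TopologicalSpace.Opens C2} (T : Current Ω) (V : Set C2)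
    (u : C2 → EReal) : Prop :=
  IsPsh u V ∧ LocallyIntegrableOn (fun z => (u z).toReal) V ∧
  ∀ α : TestForm Ω, tsupport α ⊆ V → T α = ∫ z, (((u z).toReal : ℝ) : ℂ) * ddc α z

/-- `f ∈ W^{1,2}_loc(V)`: the function and its weak gradient `G` are locally square integrable. -/
def IsW12Loc (f : C2 → ℝ) (V : Set C2) : Prop :=
  (∀ K ⊆ V, IsCompact K → MemLp f 2 (volume.restrict K)) ∧
  ∃ G : C2 → C2 →L[ℝ] ℝ, (∀ K ⊆ V, IsCompact K → MemLp G 2 (volume.restrict K)) ∧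
    ∀ φ : C2 → ℝ, ContDiff ℝ (⊤ : ℕ∞) φ → HasCompactSupport φ → tsupport φ ⊆ V →
      ∀ e : C2, ∫ z, f z * fderiv ℝ φ z e = - ∫ z, G z e * φ z

/-- `T` has (local) psh potentials in `W^{1,2}_loc(Ω)`: every point of `Ω` has an open
neighbourhood on which `T` has a psh potential that belongs to `W^{1,2}_loc`. -/
def HasPshPotentialsW12Loc {Ω : TopologicalSpace.Opens C2} (T : Current Ω) : Prop :=
  ∀ p ∈ Ω, ∃ V : Set C2, IsOpen V ∧ p ∈ V ∧ V ⊆ Ω ∧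
    ∃ u : C2 → EReal, IsPshPotential T V u ∧ IsW12Loc (fun z => (u z).toReal) V

/-! ### The blow-up of an open subset of `ℂ²` at the origin -/

/-- The blow-up `Y = {(z, ℓ) ∈ B × ℙ¹ : z ∈ ℓ}`; the blow-down map `π` is the first projection. -/
def blowUp (B : TopologicalSpace.Opens C2) : Set (C2 × Projectivization ℂ C2) :=
  {y | y.1 ∈ B ∧ y.1 ∈ y.2.submodule}

/-- The exceptional divisor `E = π⁻¹(0)`. -/
def exceptionalDivisor (B : TopologicalSpace.Opens C2) : Set (C2 × Projectivization ℂ C2) :=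
  {y | y ∈ blowUp B ∧ y.1 = 0}

/-- The direction `(1, t)` or `(t, 1)`. -/
def direction (i : Fin 2) (t : ℂ) : C2 := if i = 0 then (1, t) else (t, 1)

lemma direction_ne_zero (i : Fin 2) (t : ℂ) : direction i t ≠ 0 := by
  unfold direction
  split_ifs <;> simp [Prod.ext_iff]

/-- The two standard charts of the blow-up (as parametrizations):
`(s, t) ↦ ((s, s t), [1 : t])` and `(s, t) ↦ ((s t, s), [t : 1])`. -/
def chart (i : Fin 2) (q : C2) : C2 × Projectivization ℂ C2 :=
  (q.1 • direction i q.2, Projectivization.mk ℂ (direction i q.2) (direction_ne_zero i q.2))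

lemma chart_mem_blowUp_iff (B : TopologicalSpace.Opens C2) (i : Fin 2) (q : C2) :
    chart i q ∈ blowUp B ↔ q.1 • direction i q.2 ∈ B := by
  constructor
  · exact fun h => h.1
  · refine fun h => ⟨h, ?_⟩
    simp only [chart, Projectivization.submodule_mk]
    exact Submodule.smul_mem _ _ (Submodule.mem_span_singleton_self _)

/-- The domain of the `i`-th chart. -/
def chartDomain (B : TopologicalSpace.Opens C2) (i : Fin 2) : TopologicalSpace.Opens C2 :=
  ⟨{q | chart i q ∈ blowUp B}, by
    have h : {q | chart i q ∈ blowUp B} = (fun q : C2 => q.1 • direction i q.2) ⁻¹' B := by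
      ext q
      exact chart_mem_blowUp_iff B i q
    rw [h]
    refine B.isOpen.preimage ?_
    unfold direction
    split_ifs <;> fun_prop⟩

/-- The two charts cover the blow-up. -/
lemma exists_chart_eq (B : TopologicalSpace.Opens C2) {y : C2 × Projectivization ℂ C2}
    (hy : y ∈ blowUp B) : ∃ i, ∃ q ∈ chartDomain B i, chart i q = y := by
  obtain ⟨z, l⟩ := y
  suffices h : ∃ i q, chart i q = (z, l) by
    obtain ⟨i, q, h⟩ := h
    exact ⟨i, q, by change chart i q ∈ blowUp B; rwa [h], h⟩
  obtain ⟨hz, hl⟩ := hy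
  induction l using Projectivization.ind with
  | h v hv =>
    simp only [Projectivization.submodule_mk, Submodule.mem_span_singleton] at hl
    obtain ⟨a, rfl⟩ := hl
    by_cases h1 : v.1 = 0
    · have h2 : v.2 ≠ 0 := fun h2 => hv (Prod.ext h1 h2)
      refine ⟨1, (a * v.2, 0), ?_⟩
      simp only [chart, Prod.mk.injEq, Projectivization.mk_eq_mk_iff']
      refine ⟨?_, v.2⁻¹, ?_⟩ <;> ext <;> simp [direction, h1, h2]
    · refine ⟨0, (a * v.1, v.2 / v.1), ?_⟩
      simp only [chart, Prod.mk.injEq, Projectivization.mk_eq_mk_iff']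
      refine ⟨?_, v.1⁻¹, ?_⟩ <;> ext <;> simp [direction] <;> field_simp

/-- Each chart is injective. -/
lemma chart_injective (i : Fin 2) : Function.Injective (chart i) := by
  rintro ⟨s, t⟩ ⟨s', t'⟩ h
  simp only [chart, Prod.mk.injEq, Projectivization.mk_eq_mk_iff'] at h
  obtain ⟨h1, a, h2⟩ := h
  have h3 := congrArg Prod.fst h1
  have h4 := congrArg Prod.snd h1
  have h5 := congrArg Prod.fst h2
  have h6 := congrArg Prod.snd h2
  unfold direction at h3 h4 h5 h6
  split_ifs at h3 h4 h5 h6 <;> simp at h3 h4 h5 h6 <;> simp_all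

/-- The transition map between the two charts, in either direction, defined for `t ≠ 0`. -/
def transition (q : C2) : C2 := (q.1 * q.2, q.2⁻¹)

lemma chart_transition {q : C2} (hq : q.2 ≠ 0) : chart 1 (transition q) = chart 0 q := by
  simp only [chart, Prod.mk.injEq, Projectivization.mk_eq_mk_iff']
  refine ⟨?_, q.2⁻¹, ?_⟩ <;> ext <;> simp [direction, transition, hq]

/-- In the charts the exceptional divisor is the line `{s = 0}`. -/
lemma chart_mem_exceptionalDivisor_iff (B : TopologicalSpace.Opens C2) (i : Fin 2) {q : C2}
    (hq : q ∈ chartDomain B i) : chart i q ∈ exceptionalDivisor B ↔ q.1 = 0 := by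
  have h : chart i q ∈ exceptionalDivisor B ↔ q.1 • direction i q.2 = 0 :=
    ⟨fun h => h.2, fun h => ⟨hq, h⟩⟩
  rw [h, smul_eq_zero, or_iff_left (direction_ne_zero i q.2)]

/-- The coefficients of the pull-back `f^*β` of a `(1,1)`-form under a holomorphic map `f`. -/
def pullbackForm (f : C2 → C2) (β : C2 → Fin 2 → Fin 2 → ℂ) (q : C2) (j k : Fin 2) : ℂ :=
  ∑ l, ∑ m, β (f q) l m * coord l (fderiv ℂ f q (basisVec j)) *
    (starRingEnd ℂ) (coord m (fderiv ℂ f q (basisVec k)))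

/-- A current of bidegree `(1,1)` on the blow-up of `B`: a pair of currents on the domains of the
two charts which agree on the overlap `{t ≠ 0}`, that is, take the same values on test forms
supported in the overlap that correspond to each other under the transition map. -/
structure BlowUpCurrent (B : TopologicalSpace.Opens C2) where
  /-- The current in the `i`-th chart. -/
  inChart : (i : Fin 2) → Current (chartDomain B i)
  compatible : ∀ (α : TestForm (chartDomain B 0)) (β : TestForm (chartDomain B 1)),
    tsupport α ⊆ {q | q.2 ≠ 0} → tsupport β ⊆ {q | q.2 ≠ 0} →
    (∀ q, q.2 ≠ 0 → ∀ j k, α q j k = pullbackForm transition β q j k) →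
    inChart 0 α = inChart 1 β

/-- The current of integration `[E]` in the `i`-th chart, where `E = {s = 0}`:
`∫_E α = ∫ α_{22}(0, t) i dt ∧ dt̄`, and `i dt ∧ dt̄` is twice Lebesgue measure. -/
def integrationE (B : TopologicalSpace.Opens C2) (i : Fin 2) (α : TestForm (chartDomain B i)) : ℂ :=
  ∫ t : ℂ, 2 * α (0, t) 1 1

/-- `S = π^*T`: locally on `B` one has `T = dd^c u` with `u` psh, and `S = dd^c (u ∘ π)`. -/
def IsPullback {B : TopologicalSpace.Opens C2} (T : Current B) (S : BlowUpCurrent B) : Prop :=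
  ∀ p ∈ B, ∃ V : Set C2, IsOpen V ∧ p ∈ V ∧ V ⊆ B ∧
    ∃ u : C2 → EReal, IsPshPotential T V u ∧
      ∀ i, IsPshPotential (S.inChart i) {q | (chart i q).1 ∈ V} (fun q => u (chart i q).1)

/-- A current on the blow-up has (local) psh potentials in `W^{1,2}_loc(Y)`. These properties are
local and invariant under the transition map, and are read off in the two charts. -/
def BlowUpCurrent.HasPshPotentialsW12Loc {B : TopologicalSpace.Opens C2} (R : BlowUpCurrent B) :
    Prop :=
  ∀ i, BlowDown.HasPshPotentialsW12Loc (R.inChart i)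

end BlowDown

end

/-!
# Descent of `W^{1,2}` potentials from the blow-up of a point of a complex surface

Let `u` be a potential of `T` such that `u ∘ π` is a potential of `π^*T`. In a chart `(s, t)` of the
blow-up, the exceptional divisor is `{s = 0}` and `[E] = dd^c log |s|`
(`integral_log_mul_partialLaplacian_zero`). If `v` is a `W^{1,2}` potential of `R = π^*T - ν [E]`,
the distribution `u ∘ π - v - ν log |s|` is therefore annihilated by `dd^c`, hence by the Laplacian
in each of the two variables, and by Weyl's lemma
(`exists_contDiff_ae_eq_of_integral_partialLaplacian_eq_zero`) it is a smooth function. So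
`u ∘ π = v + ν log |s| + smooth` near every point of the chart.

Now `π` has Jacobian `|s|²` and the inverse of its derivative has size `1 / |s|`. Under the change
of variables, the square of the gradient of `v` is integrated against `|s|² · |s|⁻²`, which is
bounded. The gradient of `log |s|` is not square integrable upstairs, but it is orthogonal to the
direction in which `dπ` degenerates, so its image in `ℂ²` is only of size `1 / |s|`, and the
Jacobian makes it square integrable as well (`norm_smul_fderiv_regLog_comp_le`). Hence `u` is in
`W^{1,2}` on the image under `π` of a neighbourhood of each point, the divisor removed
(`exists_isW12On_image_blowDown`); the weak gradient descends because the Piola transform of a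
constant vector field is divergence free (`divergence_piolaField`). By compactness of `E`, `u` is in
`W^{1,2}` on a punctured neighbourhood of `0`, and a point is removable for `W^{1,2}` in real
dimension four (`isW12On_of_diff_zero`).

Finally two potentials of `T` differ by a smooth function, again by Weyl's lemma
(`IsPshPotential.exists_ae_eq_add`), so that every potential of `T` is in `W^{1,2}_loc`.
-/

noncomputable section

namespace BlowDown

/-! ### Weak gradients -/

instance : (volume : Measure C2).IsAddHaarMeasure := by
  rw [Measure.volume_eq_prod]
  infer_instance

/-- `G` is the gradient of `f` on `V` in the sense of distributions. -/
def HasWeakGrad (f : C2 → ℝ) (G : C2 → C2 →L[ℝ] ℝ) (V : Set C2) : Prop :=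
  ∀ φ : C2 → ℝ, ContDiff ℝ (⊤ : ℕ∞) φ → HasCompactSupport φ → tsupport φ ⊆ V →
    ∀ e : C2, ∫ z, f z * fderiv ℝ φ z e = - ∫ z, G z e * φ z

/-- `f` belongs to the (global) Sobolev space `W^{1,2}(V)`, with weak gradient `G`. -/
structure IsW12With (f : C2 → ℝ) (G : C2 → C2 →L[ℝ] ℝ) (V : Set C2) : Prop where
  memLp : MemLp f 2 (volume.restrict V)
  memLp_grad : MemLp G 2 (volume.restrict V)
  weakGrad : HasWeakGrad f G V

/-- `f` belongs to the (global) Sobolev space `W^{1,2}(V)`. -/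
def IsW12On (f : C2 → ℝ) (V : Set C2) : Prop := ∃ G, IsW12With f G V

lemma integrable_mul_of_tsupport_subset {f ψ : C2 → ℝ} {V : Set C2}
    (hf : LocallyIntegrableOn f V) (hψ : Continuous ψ) (hc : HasCompactSupport ψ)
    (hV : tsupport ψ ⊆ V) : Integrable fun z => f z * ψ z := by
  have h1 : IntegrableOn (fun z => f z * ψ z) (tsupport ψ) :=
    (hf.integrableOn_compact_subset hV hc).mul_continuousOn hψ.continuousOn hc
  refine (integrableOn_iff_integrable_of_support_subset fun z hz => ?_).1 h1
  exact subset_tsupport _ (right_ne_zero_of_mul hz)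

lemma integrable_smul_of_tsupport_subset {F : Type*} [NormedAddCommGroup F] [NormedSpace ℝ F]
    {f : C2 → F} {ψ : C2 → ℝ} {V : Set C2} (hf : LocallyIntegrableOn f V) (hψ : Continuous ψ)
    (hc : HasCompactSupport ψ) (hV : tsupport ψ ⊆ V) : Integrable fun z => ψ z • f z := by
  have h1 : IntegrableOn (fun z => ψ z • f z) (tsupport ψ) :=
    (hf.integrableOn_compact_subset hV hc).continuousOn_smul hψ.continuousOn hc
  refine (integrableOn_iff_integrable_of_support_subset fun z hz => ?_).1 h1
  refine subset_tsupport _ fun h0 => hz ?_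
  simp [h0]

lemma tsupport_fderiv_apply_const_subset (φ : C2 → ℝ) (e : C2) :
    tsupport (fun z => fderiv ℝ φ z e) ⊆ tsupport φ :=
  closure_minimal (fun _ hz => support_fderiv_subset ℝ fun h => hz (by simp [h]))
    (isClosed_tsupport φ)

lemma hasCompactSupport_fderiv_apply_const {φ : C2 → ℝ} (hc : HasCompactSupport φ) (e : C2) :
    HasCompactSupport fun z => fderiv ℝ φ z e :=
  hc.of_isClosed_subset (isClosed_tsupport _) (tsupport_fderiv_apply_const_subset φ e)

lemma contDiff_fderiv_apply_const {φ : C2 → ℝ} (hφ : ContDiff ℝ (⊤ : ℕ∞) φ) (e : C2) :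
    ContDiff ℝ (⊤ : ℕ∞) fun z => fderiv ℝ φ z e :=
  (hφ.fderiv_right (m := (⊤ : ℕ∞)) (by simp)).clm_apply contDiff_const

lemma integrable_mul_fderiv {f φ : C2 → ℝ} {V : Set C2} (hf : LocallyIntegrableOn f V)
    (hφ : ContDiff ℝ (⊤ : ℕ∞) φ) (hc : HasCompactSupport φ) (hV : tsupport φ ⊆ V) (e : C2) :
    Integrable fun z => f z * fderiv ℝ φ z e :=
  integrable_mul_of_tsupport_subset hf (contDiff_fderiv_apply_const hφ e).continuous
    (hasCompactSupport_fderiv_apply_const hc e)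
    ((tsupport_fderiv_apply_const_subset φ e).trans hV)

lemma integrable_clm_mul {G : C2 → C2 →L[ℝ] ℝ} {φ : C2 → ℝ} {V : Set C2}
    (hG : LocallyIntegrableOn G V) (hφ : Continuous φ) (hc : HasCompactSupport φ)
    (hV : tsupport φ ⊆ V) (e : C2) : Integrable fun z => G z e * φ z := by
  refine integrable_mul_of_tsupport_subset (V := V) (fun x hx => ?_) hφ hc hV
  obtain ⟨U, hU, hi⟩ := hG x hx
  exact ⟨U, hU, hi.apply_continuousLinearMap e⟩

lemma locallyIntegrableOn_of_memLp {F : Type*} [NormedAddCommGroup F] {f : C2 → F} {V : Set C2}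
    (hf : MemLp f 2 (volume.restrict V)) : LocallyIntegrableOn f V := by
  intro x _
  refine ⟨V ∩ Metric.ball x 1, inter_mem_nhdsWithin _ (Metric.ball_mem_nhds x one_pos), ?_⟩
  have h := hf.mono_measure (Measure.restrict_mono (Set.inter_subset_left (t := Metric.ball x 1))
    le_rfl)
  have : IsFiniteMeasure (volume.restrict (V ∩ Metric.ball x 1)) :=
    ⟨by simpa using (measure_mono Set.inter_subset_right).trans_lt measure_ball_lt_top⟩
  exact h.integrable (by norm_num)

lemma HasWeakGrad.mono {f : C2 → ℝ} {G : C2 → C2 →L[ℝ] ℝ} {V W : Set C2}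
    (h : HasWeakGrad f G V) (hWV : W ⊆ V) : HasWeakGrad f G W :=
  fun φ hφ hc hs e => h φ hφ hc (hs.trans hWV) e

lemma IsW12With.mono {f : C2 → ℝ} {G : C2 → C2 →L[ℝ] ℝ} {V W : Set C2}
    (h : IsW12With f G V) (hWV : W ⊆ V) : IsW12With f G W :=
  ⟨h.memLp.mono_measure (Measure.restrict_mono hWV le_rfl),
    h.memLp_grad.mono_measure (Measure.restrict_mono hWV le_rfl), h.weakGrad.mono hWV⟩

lemma IsW12On.mono {f : C2 → ℝ} {V W : Set C2} (h : IsW12On f V) (hWV : W ⊆ V) : IsW12On f W :=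
  ⟨h.choose, h.choose_spec.mono hWV⟩

lemma integral_mul_congr_of_ae {f f' ψ : C2 → ℝ} {V : Set C2} (hV : MeasurableSet V)
    (h : f =ᵐ[volume.restrict V] f') (hψ : tsupport ψ ⊆ V) :
    ∫ z, f z * ψ z = ∫ z, f' z * ψ z := by
  rw [Filter.EventuallyEq, ae_restrict_iff' hV] at h
  refine integral_congr_ae ?_
  filter_upwards [h] with z hz
  by_cases hzV : z ∈ V
  · rw [hz hzV]
  · simp [image_eq_zero_of_notMem_tsupport fun h' => hzV (hψ h')]

lemma HasWeakGrad.congr_ae {f f' : C2 → ℝ} {G G' : C2 → C2 →L[ℝ] ℝ} {V : Set C2}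
    (hV : MeasurableSet V) (h : HasWeakGrad f G V) (hf : f =ᵐ[volume.restrict V] f')
    (hG : G =ᵐ[volume.restrict V] G') : HasWeakGrad f' G' V := by
  intro φ hφ hc hs e
  rw [← integral_mul_congr_of_ae hV hf ((tsupport_fderiv_apply_const_subset φ e).trans hs),
    ← integral_mul_congr_of_ae hV (f := fun z => G z e) (f' := fun z => G' z e) ?_ hs]
  · exact h φ hφ hc hs e
  · filter_upwards [hG] with z hz
    rw [hz]

lemma IsW12With.congr_ae {f f' : C2 → ℝ} {G G' : C2 → C2 →L[ℝ] ℝ} {V : Set C2}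
    (hV : MeasurableSet V) (h : IsW12With f G V) (hf : f =ᵐ[volume.restrict V] f')
    (hG : G =ᵐ[volume.restrict V] G') : IsW12With f' G' V :=
  ⟨h.memLp.ae_eq hf, h.memLp_grad.ae_eq hG, h.weakGrad.congr_ae hV hf hG⟩

lemma HasWeakGrad.add {f g : C2 → ℝ} {G H : C2 → C2 →L[ℝ] ℝ} {V : Set C2}
    (hf : LocallyIntegrableOn f V) (hG : LocallyIntegrableOn G V)
    (hg : LocallyIntegrableOn g V) (hH : LocallyIntegrableOn H V)
    (h : HasWeakGrad f G V) (h' : HasWeakGrad g H V) :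
    HasWeakGrad (fun z => f z + g z) (fun z => G z + H z) V := by
  intro φ hφ hc hs e
  simp only [add_mul, _root_.add_apply]
  rw [integral_add (integrable_mul_fderiv hf hφ hc hs e) (integrable_mul_fderiv hg hφ hc hs e),
    integral_add (integrable_clm_mul hG hφ.continuous hc hs e)
      (integrable_clm_mul hH hφ.continuous hc hs e), h φ hφ hc hs e, h' φ hφ hc hs e]
  ring

lemma HasWeakGrad.const_mul {f : C2 → ℝ} {G : C2 → C2 →L[ℝ] ℝ} {V : Set C2}
    (h : HasWeakGrad f G V) (c : ℝ) :
    HasWeakGrad (fun z => c * f z) (fun z => c • G z) V := by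
  intro φ hφ hc hs e
  simp only [mul_assoc, _root_.smul_apply, smul_eq_mul, integral_const_mul]
  rw [h φ hφ hc hs e]
  ring

lemma memLp_fun_add {F : Type*} [NormedAddCommGroup F] {f g : C2 → F} {μ : Measure C2}
    (hf : MemLp f 2 μ) (hg : MemLp g 2 μ) : MemLp (fun z => f z + g z) 2 μ :=
  hf.add hg

lemma IsW12On.add {f g : C2 → ℝ} {V : Set C2} (hf : IsW12On f V) (hg : IsW12On g V) :
    IsW12On (fun z => f z + g z) V := by
  obtain ⟨G, hG⟩ := hf
  obtain ⟨H, hH⟩ := hg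
  have h1 : MemLp (fun z => f z + g z) 2 (volume.restrict V) := hG.memLp.add hH.memLp
  have h2 : MemLp (fun z => G z + H z) 2 (volume.restrict V) :=
    memLp_fun_add hG.memLp_grad hH.memLp_grad
  have hf := locallyIntegrableOn_of_memLp hG.memLp
  have hf' := locallyIntegrableOn_of_memLp hG.memLp_grad
  have hg := locallyIntegrableOn_of_memLp hH.memLp
  have hg' := locallyIntegrableOn_of_memLp hH.memLp_grad
  exact ⟨_, h1, h2, hG.weakGrad.add hf hf' hg hg' hH.weakGrad⟩

/-- The integral of a directional derivative of a compactly supported function vanishes. -/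
lemma integral_fderiv_eq_zero {φ : C2 → ℝ} (hφ : ContDiff ℝ 1 φ) (hc : HasCompactSupport φ)
    (e : C2) : ∫ z, fderiv ℝ φ z e = 0 := by
  have hc' := hasCompactSupport_fderiv_apply_const hc e
  have h' : Continuous fun z => fderiv ℝ φ z e :=
    (hφ.continuous_fderiv one_ne_zero).clm_apply continuous_const
  have h := integral_mul_fderiv_eq_neg_fderiv_mul_of_integrable (μ := (volume : Measure C2))
    (f := fun _ => (1 : ℝ)) (g := φ) (v := e) (by simp)
    (by simpa using h'.integrable_of_hasCompactSupport hc')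
    (by simpa using hφ.continuous.integrable_of_hasCompactSupport hc)
    (fun x _ => differentiableAt_const _) (fun x _ => hφ.differentiable one_ne_zero x)
  simpa using h

lemma hasWeakGrad_of_contDiffOn {f : C2 → ℝ} {V : Set C2} (hV : IsOpen V)
    (hf : ContDiffOn ℝ (⊤ : ℕ∞) f V) : HasWeakGrad f (fderiv ℝ f) V := by
  intro φ hφ hc hs e
  have hprod : ContDiff ℝ (⊤ : ℕ∞) fun z => f z * φ z := by
    rw [contDiff_iff_contDiffAt]
    intro z
    by_cases hz : z ∈ tsupport φ
    · exact (hf.contDiffAt (hV.mem_nhds (hs hz))).mul hφ.contDiffAt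
    · refine (contDiffAt_const (c := (0 : ℝ))).congr_of_eventuallyEq ?_
      filter_upwards [(isClosed_tsupport φ).isOpen_compl.mem_nhds hz] with w hw
      simp [image_eq_zero_of_notMem_tsupport hw]
  have hcp : HasCompactSupport fun z => f z * φ z := hc.mul_left
  have h0 := integral_fderiv_eq_zero (hprod.of_le (by simp)) hcp e
  have hfl : LocallyIntegrableOn f V := hf.continuousOn.locallyIntegrableOn hV.measurableSet
  have hfl' : LocallyIntegrableOn (fderiv ℝ f) V :=
    (hf.continuousOn_fderiv_of_isOpen hV (by simp)).locallyIntegrableOn hV.measurableSet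
  have hpt : ∀ z, fderiv ℝ (fun z => f z * φ z) z e
      = f z * fderiv ℝ φ z e + fderiv ℝ f z e * φ z := by
    intro z
    by_cases hz : z ∈ tsupport φ
    · have h1 : DifferentiableAt ℝ f z :=
        (hf.contDiffAt (hV.mem_nhds (hs hz))).differentiableAt (by simp)
      rw [fderiv_fun_mul h1 (hφ.differentiable (by simp) z)]
      simp [mul_comm]
    · have h1 : (fun z => f z * φ z) =ᶠ[𝓝 z] fun _ => 0 := by
        filter_upwards [(isClosed_tsupport φ).isOpen_compl.mem_nhds hz] with w hw
        simp [image_eq_zero_of_notMem_tsupport hw]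
      have h2 : fderiv ℝ φ z e = 0 := by
        have := fun h => hz (tsupport_fderiv_apply_const_subset φ e h)
        exact image_eq_zero_of_notMem_tsupport (f := fun z => fderiv ℝ φ z e) this
      rw [h1.fderiv_eq, h2, image_eq_zero_of_notMem_tsupport hz]
      simp
  simp only [hpt] at h0
  rw [integral_add (integrable_mul_fderiv hfl hφ hc hs e)
    (integrable_clm_mul hfl' hφ.continuous hc hs e)] at h0
  linarith

/-- Since `W^{1,2}(V)` is global, boundedness of `V` is needed even for smooth functions. -/
lemma isW12On_of_contDiff {f : C2 → ℝ} (hf : ContDiff ℝ (⊤ : ℕ∞) f) {V : Set C2} (hV : IsOpen V)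
    (hb : Bornology.IsBounded V) : IsW12On f V := by
  have key : ∀ {F : Type} [NormedAddCommGroup F] {g : C2 → F}, Continuous g →
      MemLp g 2 (volume.restrict V) := by
    intro F _ g hg
    obtain ⟨R, hR⟩ := hb.subset_closedBall 0
    obtain ⟨C, hC⟩ := (isCompact_closedBall (0 : C2) R).exists_bound_of_continuousOn hg.continuousOn
    have : IsFiniteMeasure (volume.restrict V) := ⟨by simpa using hb.measure_lt_top⟩
    refine MemLp.of_bound hg.aestronglyMeasurable C ?_
    filter_upwards [ae_restrict_mem hV.measurableSet] with z hz using hC z (hR hz)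
  exact ⟨_, key hf.continuous, key (hf.continuous_fderiv (by simp)),
    hasWeakGrad_of_contDiffOn hV hf.contDiffOn⟩

/-- Weak gradients are unique almost everywhere. -/
lemma HasWeakGrad.ae_eq {f : C2 → ℝ} {G H : C2 → C2 →L[ℝ] ℝ} {V : Set C2} (hV : IsOpen V)
    (hG : LocallyIntegrableOn G V) (hH : LocallyIntegrableOn H V)
    (h : HasWeakGrad f G V) (h' : HasWeakGrad f H V) : G =ᵐ[volume.restrict V] H := by
  rw [Filter.EventuallyEq, ae_restrict_iff' hV.measurableSet]
  have key := hV.ae_eq_zero_of_integral_contDiff_smul_eq_zero (hG.sub hH) (μ := volume) ?_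
  · filter_upwards [key] with z hz hzV
    exact sub_eq_zero.1 (hz hzV)
  · intro φ hφ hc hs
    have hint : Integrable fun z => φ z • (G - H) z :=
      integrable_smul_of_tsupport_subset (hG.sub hH) hφ.continuous hc hs
    refine ContinuousLinearMap.ext fun e => ?_
    rw [ContinuousLinearMap.integral_apply hint]
    have h1 := h φ hφ hc hs e
    have h2 := h' φ hφ hc hs e
    have h3 := integral_sub (integrable_clm_mul hG hφ.continuous hc hs e)
      (integrable_clm_mul hH hφ.continuous hc hs e)
    have h4 : ∀ z, (φ z • (G - H) z) e = G z e * φ z - H z e * φ z := by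
      intro z
      simp
      ring
    simp only [h4, h3, _root_.zero_apply]
    linarith

/-! ### Gluing and removable points -/

lemma memLp_two_union {F : Type*} [NormedAddCommGroup F] {f : C2 → F} {U V : Set C2}
    (hU : MemLp f 2 (volume.restrict U)) (hV : MemLp f 2 (volume.restrict V)) :
    MemLp f 2 (volume.restrict (U ∪ V)) := by
  have hm : AEStronglyMeasurable f (volume.restrict (U ∪ V)) :=
    aestronglyMeasurable_union_iff.2 ⟨hU.1, hV.1⟩
  rw [memLp_two_iff_integrable_sq_norm hm]
  exact IntegrableOn.union ((memLp_two_iff_integrable_sq_norm hU.1).1 hU)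
    ((memLp_two_iff_integrable_sq_norm hV.1).1 hV)

/-- A test function supported in `U ∪ V` is the sum of test functions supported in `U` and `V`. -/
lemma exists_add_of_tsupport_subset_union {φ : C2 → ℝ} (hφ : ContDiff ℝ (⊤ : ℕ∞) φ)
    (hc : HasCompactSupport φ) {U V : Set C2} (hU : IsOpen U) (hV : IsOpen V)
    (hs : tsupport φ ⊆ U ∪ V) :
    ∃ φ₁ φ₂ : C2 → ℝ, ContDiff ℝ (⊤ : ℕ∞) φ₁ ∧ ContDiff ℝ (⊤ : ℕ∞) φ₂ ∧
      HasCompactSupport φ₁ ∧ HasCompactSupport φ₂ ∧ tsupport φ₁ ⊆ U ∧ tsupport φ₂ ⊆ V ∧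
      ∀ z, φ z = φ₁ z + φ₂ z := by
  obtain ⟨χ, h0, h1, -⟩ := exists_contMDiffMap_zero_one_nhds_of_isClosed
    (modelWithCornersSelf ℝ C2) (s := tsupport φ \ V) (t := tsupport φ \ U)
    ((isClosed_tsupport φ).sdiff hV) ((isClosed_tsupport φ).sdiff hU) (by
      rw [Set.disjoint_left]
      rintro x ⟨hx, hx1⟩ ⟨-, hx2⟩
      exact (hs hx).elim hx2 hx1)
  have hχ : ContDiff ℝ (⊤ : ℕ∞) χ := χ.contMDiff.contDiff
  have key : ∀ (ψ : C2 → ℝ) (W : Set C2), (∀ᶠ x in 𝓝ˢ (tsupport φ \ W), ψ x = 0) →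
      tsupport (fun z => ψ z * φ z) ⊆ W := by
    intro ψ W h x hx
    by_contra hxW
    have hxφ : x ∈ tsupport φ := tsupport_mul_subset_right hx
    refine notMem_tsupport_iff_eventuallyEq.2 ?_ hx
    filter_upwards [eventually_nhdsSet_iff_forall.1 h x ⟨hxφ, hxW⟩] with y hy
    simp [hy]
  refine ⟨fun z => (1 - χ z) * φ z, fun z => χ z * φ z, (contDiff_const.sub hχ).mul hφ,
    hχ.mul hφ, hc.mul_left, hc.mul_left, key _ _ ?_, key _ _ h0, fun z => by ring⟩
  filter_upwards [h1] with x hx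
  simp [hx]

/-- Being a weak gradient is a local property, by a partition of unity. -/
lemma HasWeakGrad.union {f : C2 → ℝ} {G : C2 → C2 →L[ℝ] ℝ} {U V : Set C2}
    (hU : IsOpen U) (hV : IsOpen V) (hf : LocallyIntegrableOn f (U ∪ V))
    (hG : LocallyIntegrableOn G (U ∪ V)) (h : HasWeakGrad f G U) (h' : HasWeakGrad f G V) :
    HasWeakGrad f G (U ∪ V) := by
  intro φ hφ hc hs e
  obtain ⟨φ₁, φ₂, d1, d2, c1, c2, s1, s2, hsum⟩ :=
    exists_add_of_tsupport_subset_union hφ hc hU hV hs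
  have hs1 := s1.trans (Set.subset_union_left (t := V))
  have hs2 := s2.trans (Set.subset_union_right (s := U))
  have hfd : ∀ z, fderiv ℝ φ z e = fderiv ℝ φ₁ z e + fderiv ℝ φ₂ z e := by
    intro z
    rw [funext hsum, fderiv_fun_add (d1.differentiable (by simp) z)
      (d2.differentiable (by simp) z)]
    rfl
  simp only [hfd, hsum, mul_add]
  rw [integral_add (integrable_mul_fderiv hf d1 c1 hs1 e) (integrable_mul_fderiv hf d2 c2 hs2 e),
    integral_add (integrable_clm_mul hG d1.continuous c1 hs1 e)
      (integrable_clm_mul hG d2.continuous c2 hs2 e), h φ₁ d1 c1 s1 e, h' φ₂ d2 c2 s2 e]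
  ring

lemma IsW12On.union {f : C2 → ℝ} {U V : Set C2} (hU : IsOpen U) (hV : IsOpen V)
    (h : IsW12On f U) (h' : IsW12On f V) : IsW12On f (U ∪ V) := by
  classical
  obtain ⟨G, hG⟩ := h
  obtain ⟨H, hH⟩ := h'
  have huniq : ∀ᵐ z, z ∈ U ∩ V → G z = H z := by
    have := HasWeakGrad.ae_eq (hU.inter hV)
      (locallyIntegrableOn_of_memLp (hG.mono Set.inter_subset_left).memLp_grad)
      (locallyIntegrableOn_of_memLp (hH.mono Set.inter_subset_right).memLp_grad)
      (hG.mono Set.inter_subset_left).weakGrad (hH.mono Set.inter_subset_right).weakGrad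
    rwa [Filter.EventuallyEq, ae_restrict_iff' (hU.inter hV).measurableSet] at this
  have e1 : G =ᵐ[volume.restrict U] U.piecewise G H := by
    filter_upwards [ae_restrict_mem hU.measurableSet] with z hz
    simp [hz]
  have e2 : H =ᵐ[volume.restrict V] U.piecewise G H := by
    rw [Filter.EventuallyEq, ae_restrict_iff' hV.measurableSet]
    filter_upwards [huniq] with z hz hzV
    by_cases hzU : z ∈ U
    · simp [hzU, hz ⟨hzU, hzV⟩]
    · simp [hzU]
  have hG' := hG.congr_ae hU.measurableSet ae_eq_rfl e1
  have hH' := hH.congr_ae hV.measurableSet ae_eq_rfl e2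
  have m1 := memLp_two_union hG'.memLp hH'.memLp
  have m2 := memLp_two_union hG'.memLp_grad hH'.memLp_grad
  exact ⟨_, m1, m2, hG'.weakGrad.union hU hV (locallyIntegrableOn_of_memLp m1)
    (locallyIntegrableOn_of_memLp m2) hH'.weakGrad⟩

lemma isW12On_empty (f : C2 → ℝ) : IsW12On f ∅ :=
  ⟨0, by simp, by simp, fun φ _ _ hs e => by
    have : φ = 0 := by
      ext z
      exact image_eq_zero_of_notMem_tsupport fun h => hs h
    simp [this]⟩

lemma isW12On_biUnion {ι : Type*} (f : C2 → ℝ) (U : ι → Set C2) (s : Finset ι)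
    (hU : ∀ i ∈ s, IsOpen (U i)) (h : ∀ i ∈ s, IsW12On f (U i)) : IsW12On f (⋃ i ∈ s, U i) := by
  classical
  induction s using Finset.induction_on with
  | empty => simpa using isW12On_empty f
  | insert a s ha ih =>
    rw [Finset.set_biUnion_insert]
    refine IsW12On.union (hU a (by simp))
      (isOpen_biUnion fun i hi => hU i (Finset.mem_insert_of_mem hi)) (h a (by simp))
      (ih (fun i hi => hU i (by simp [hi])) fun i hi => h i (by simp [hi]))

/-- A function that belongs to `W^{1,2}` near every point of `V` belongs to `W^{1,2}_loc(V)`. -/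
lemma isW12Loc_of_forall_exists {f : C2 → ℝ} {V : Set C2}
    (h : ∀ p ∈ V, ∃ U : Set C2, IsOpen U ∧ p ∈ U ∧ IsW12On f U) : IsW12Loc f V := by
  classical
  rcases V.eq_empty_or_nonempty with rfl | ⟨p₀, hp₀⟩
  · refine ⟨fun K hK _ => by simp [Set.subset_empty_iff.1 hK], 0,
      fun K hK _ => by simp [Set.subset_empty_iff.1 hK], fun φ _ _ hs e => ?_⟩
    have : φ = 0 := by
      ext z
      exact image_eq_zero_of_notMem_tsupport fun h => hs h
    simp [this]
  choose! U hUo hUp hUW using h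
  obtain ⟨t, htV, htc, htU⟩ := TopologicalSpace.countable_cover_nhdsWithin (s := V) (f := U)
    fun x hx => mem_nhdsWithin_of_mem_nhds ((hUo x hx).mem_nhds (hUp x hx))
  have htne : t.Nonempty := by
    obtain ⟨x, hx, -⟩ := Set.mem_iUnion₂.1 (htU hp₀)
    exact ⟨x, hx⟩
  obtain ⟨s, rfl⟩ := htc.exists_eq_range htne
  -- an increasing sequence of open sets covering `V`; the weak gradients on them agree almost
  -- everywhere and define `H` below, and every compact subset of `V` lies in one of the sets
  have hsV : ∀ n, s n ∈ V := fun n => htV ⟨n, rfl⟩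
  let W : ℕ → Set C2 := fun n => ⋃ k ∈ Finset.range (n + 1), U (s k)
  have hWo : ∀ n, IsOpen (W n) := fun n => isOpen_biUnion fun k _ => hUo _ (hsV k)
  have hWmono : Monotone W := fun m n hmn =>
    Set.biUnion_subset_biUnion_left fun k hk => by simp at hk ⊢; omega
  have hVW : V ⊆ ⋃ n, W n := by
    intro x hx
    obtain ⟨y, ⟨k, rfl⟩, hk⟩ := Set.mem_iUnion₂.1 (htU hx)
    exact Set.mem_iUnion.2 ⟨k, Set.mem_iUnion₂.2 ⟨k, by simp, hk⟩⟩
  have hWW : ∀ n, IsW12On f (W n) := fun n =>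
    isW12On_biUnion f _ _ (fun k _ => hUo _ (hsV k)) fun k _ => hUW _ (hsV k)
  choose G hG using hWW
  have huniq : ∀ᵐ z, ∀ m n, m ≤ n → z ∈ W m → G m z = G n z := by
    rw [ae_all_iff]
    intro m
    rw [ae_all_iff]
    intro n
    by_cases hmn : m ≤ n
    · have := HasWeakGrad.ae_eq (hWo m) (locallyIntegrableOn_of_memLp (hG m).memLp_grad)
        (locallyIntegrableOn_of_memLp ((hG n).mono (hWmono hmn)).memLp_grad) (hG m).weakGrad
        ((hG n).mono (hWmono hmn)).weakGrad
      rw [Filter.EventuallyEq, ae_restrict_iff' (hWo m).measurableSet] at this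
      filter_upwards [this] with z hz _ using hz
    · exact Eventually.of_forall fun z h => absurd h hmn
  let H : C2 → C2 →L[ℝ] ℝ := fun z => if h : ∃ n, z ∈ W n then G (Nat.find h) z else 0
  have hH : ∀ n, IsW12With f H (W n) := by
    intro n
    refine (hG n).congr_ae (hWo n).measurableSet ae_eq_rfl ?_
    rw [Filter.EventuallyEq, ae_restrict_iff' (hWo n).measurableSet]
    filter_upwards [huniq] with z hz hzn
    have hex : ∃ n, z ∈ W n := ⟨n, hzn⟩
    simp only [H, hex, dite_true]
    exact (hz _ _ (Nat.find_min' hex hzn) (Nat.find_spec hex)).symm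
  have hK : ∀ K ⊆ V, IsCompact K → ∃ n, K ⊆ W n := fun K hKV hK =>
    hK.elim_directed_cover W hWo (hKV.trans hVW) hWmono.directed_le
  refine ⟨fun K hKV hKc => ?_, H, fun K hKV hKc => ?_, fun φ hφ hc hs e => ?_⟩
  · obtain ⟨n, hn⟩ := hK K hKV hKc
    exact ((hH n).mono hn).memLp
  · obtain ⟨n, hn⟩ := hK K hKV hKc
    exact ((hH n).mono hn).memLp_grad
  · obtain ⟨n, hn⟩ := hK _ hs hc
    exact (hH n).weakGrad φ hφ hc hn e

/-- On a neighbourhood `U` of a given point, the local space `W^{1,2}_loc` passes into the global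
`W^{1,2}(U)`. -/
lemma IsW12Loc.exists_isW12On {f : C2 → ℝ} {V : Set C2} (hV : IsOpen V) (h : IsW12Loc f V)
    {p : C2} (hp : p ∈ V) : ∃ U : Set C2, IsOpen U ∧ p ∈ U ∧ U ⊆ V ∧ IsW12On f U := by
  obtain ⟨ε, hε, hεV⟩ := Metric.nhds_basis_closedBall.mem_iff.1 (hV.mem_nhds hp)
  obtain ⟨h1, G, h2, h3⟩ := h
  have hsub := Metric.ball_subset_closedBall (x := p) (ε := ε)
  refine ⟨Metric.ball p ε, Metric.isOpen_ball, Metric.mem_ball_self hε, hsub.trans hεV, G,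
    (h1 _ hεV (isCompact_closedBall p ε)).mono_measure (Measure.restrict_mono hsub le_rfl),
    (h2 _ hεV (isCompact_closedBall p ε)).mono_measure (Measure.restrict_mono hsub le_rfl),
    fun φ hφ hc hs e => h3 φ hφ hc (hs.trans (hsub.trans hεV)) e⟩

lemma restrict_diff_singleton (W : Set C2) (p : C2) :
    (volume : Measure C2).restrict (W \ {p}) = volume.restrict W :=
  Measure.restrict_congr_set (sdiff_null_ae_eq_self (measure_singleton p))

lemma tendsto_sq_mul_measure_closedBall :
    Tendsto (fun n : ℕ => ((n : ℝ) + 1) ^ 2 *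
      (volume : Measure C2).real (Metric.closedBall 0 (2 / ((n : ℝ) + 1)))) atTop (𝓝 0) := by
  have h : ∀ n : ℕ, ((n : ℝ) + 1) ^ 2 *
      (volume : Measure C2).real (Metric.closedBall 0 (2 / ((n : ℝ) + 1))) =
      16 * (volume : Measure C2).real (Metric.ball 0 1) * (1 / ((n : ℝ) + 1)) ^ 2 := by
    intro n
    have hn : (0 : ℝ) < n + 1 := by positivity
    have hdim : Module.finrank ℝ C2 = 4 := by simp [C2]
    rw [Measure.real, Measure.addHaar_closedBall _ _ (by positivity), hdim, ENNReal.toReal_mul,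
      ENNReal.toReal_ofReal (by positivity), Measure.real]
    field_simp
    ring
  simp only [h]
  simpa using (tendsto_one_div_add_atTop_nhds_zero_nat (𝕜 := ℝ)).pow 2 |>.const_mul
    (16 * (volume : Measure C2).real (Metric.ball 0 1))

/-- A point is removable for `W^{1,2}`: the cutoffs `1 - β(nz)` have gradients of size `n` on balls
of radius comparable to `1 / n`, whose volume is comparable to `n⁻⁴`. -/
lemma isW12On_of_diff_zero {f : C2 → ℝ} {W : Set C2} (h : IsW12On f (W \ {0})) :
    IsW12On f W := by
  obtain ⟨G, h1, h2, hw⟩ := h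
  rw [restrict_diff_singleton] at h1 h2
  refine ⟨G, h1, h2, fun φ hφ hc hs e => ?_⟩
  have hfl := locallyIntegrableOn_of_memLp h1
  have hGl := locallyIntegrableOn_of_memLp h2
  let β : ContDiffBump (0 : C2) := ⟨1, 2, one_pos, one_lt_two⟩
  have hβ : ContDiff ℝ (⊤ : ℕ∞) β := β.contDiff
  let ψ : ℕ → C2 → ℝ := fun n z => β (((n : ℝ) + 1) • z)
  have hψ : ∀ n, ContDiff ℝ (⊤ : ℕ∞) (ψ n) := fun n => hβ.comp (contDiff_const_smul _)
  have hψd : ∀ n z, fderiv ℝ (ψ n) z e = ((n : ℝ) + 1) * fderiv ℝ β (((n : ℝ) + 1) • z) e := by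
    intro n z
    have h3 : HasFDerivAt (fun z : C2 => ((n : ℝ) + 1) • z)
        (((n : ℝ) + 1) • ContinuousLinearMap.id ℝ C2) z :=
      (ContinuousLinearMap.hasFDerivAt (((n : ℝ) + 1) • ContinuousLinearMap.id ℝ C2))
    have h4 := ((hβ.differentiable (by simp)
      (((n : ℝ) + 1) • z)).hasFDerivAt.comp z h3).fderiv
    change fderiv ℝ (β ∘ fun z : C2 => ((n : ℝ) + 1) • z) z e = _
    rw [h4]
    simp
  obtain ⟨C, hC⟩ := (contDiff_fderiv_apply_const hβ e).continuous.bounded_above_of_compact_support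
    (hasCompactSupport_fderiv_apply_const β.hasCompactSupport e)
  have hψz : ∀ (n : ℕ) (z : C2), z ∉ Metric.closedBall (0 : C2) (2 / ((n : ℝ) + 1)) →
      fderiv ℝ (ψ n) z e = 0 := by
    intro n z hz
    rw [hψd]
    have hn : (0 : ℝ) < n + 1 := by positivity
    have : ((n : ℝ) + 1) • z ∉ tsupport β := by
      rw [β.tsupport_eq]
      intro h
      refine hz ?_
      rw [mem_closedBall_zero_iff, norm_smul, Real.norm_of_nonneg hn.le] at h
      rw [mem_closedBall_zero_iff, le_div_iff₀ hn]
      linarith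
    rw [image_eq_zero_of_notMem_tsupport (f := fun w => fderiv ℝ β w e)
      fun h => this (tsupport_fderiv_apply_const_subset _ e h), mul_zero]
  have hψlim : ∀ z : C2, z ≠ 0 → ∀ᶠ n : ℕ in atTop, ψ n z = 0 := by
    intro z hz
    have hz' : 0 < ‖z‖ := norm_pos_iff.2 hz
    obtain ⟨N, hN⟩ := exists_nat_gt (2 / ‖z‖)
    filter_upwards [eventually_ge_atTop N] with n hn
    refine β.zero_of_le_dist ?_
    have : (N : ℝ) ≤ n := by exact_mod_cast hn
    rw [dist_zero_right, norm_smul, Real.norm_of_nonneg (by positivity)]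
    rw [div_lt_iff₀ hz'] at hN
    change (2 : ℝ) ≤ _
    nlinarith
  have hψ01 : ∀ n z, 0 ≤ ψ n z ∧ ψ n z ≤ 1 := fun n z => ⟨β.nonneg, β.le_one⟩
  have hne : ∀ᵐ z : C2, z ≠ 0 := by
    simp [ae_iff]
  -- the identity for the test functions `(1 - ψ n) φ`, which vanish near the origin
  have hid : ∀ n, (∫ z, (1 - ψ n z) * (f z * fderiv ℝ φ z e)) -
      (∫ z, (f z * φ z) * fderiv ℝ (ψ n) z e) = - ∫ z, (1 - ψ n z) * (G z e * φ z) := by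
    intro n
    have d : ContDiff ℝ (⊤ : ℕ∞) fun z => (1 - ψ n z) * φ z := (contDiff_const.sub (hψ n)).mul hφ
    have hsupp : tsupport (fun z => (1 - ψ n z) * φ z) ⊆ W \ {0} := by
      intro z hz
      refine ⟨hs (tsupport_mul_subset_right hz), ?_⟩
      rintro rfl
      refine notMem_tsupport_iff_eventuallyEq.2 ?_ hz
      have h5 : ∀ᶠ w in 𝓝 (0 : C2), β w = 1 := β.eventuallyEq_one
      have h6 : Tendsto (fun z : C2 => ((n : ℝ) + 1) • z) (𝓝 0) (𝓝 0) :=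
        (continuous_const_smul ((n : ℝ) + 1)).tendsto' _ _ (by simp)
      filter_upwards [h6.eventually h5] with w hw
      simp [ψ, hw]
    have h7 := hw _ d hc.mul_left hsupp e
    have h8 : ∀ z, fderiv ℝ (fun z => (1 - ψ n z) * φ z) z e =
        (1 - ψ n z) * fderiv ℝ φ z e - φ z * fderiv ℝ (ψ n) z e := by
      intro z
      have h9 : DifferentiableAt ℝ (fun z => 1 - ψ n z) z :=
        (differentiableAt_const _).sub ((hψ n).differentiable (by simp) z)
      rw [fderiv_fun_mul h9 (hφ.differentiable (by simp) z), fderiv_const_sub]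
      simp
      ring
    simp only [h8] at h7
    have h9 : ∀ z, G z e * ((1 - ψ n z) * φ z) = (1 - ψ n z) * (G z e * φ z) := fun z => by ring
    simp only [h9] at h7
    rw [← h7, ← integral_sub]
    · refine integral_congr_ae (Eventually.of_forall fun z => ?_)
      ring
    · have := integrable_mul_of_tsupport_subset hfl
        ((continuous_const.sub (hψ n).continuous).mul
          (contDiff_fderiv_apply_const hφ e).continuous)
        (HasCompactSupport.mul_left (f := fun z => 1 - ψ n z)
          (hasCompactSupport_fderiv_apply_const hc e))
        ((tsupport_mul_subset_right.trans (tsupport_fderiv_apply_const_subset φ e)).trans hs)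
      refine this.congr (Eventually.of_forall fun z => ?_)
      simp only [Pi.mul_apply, Pi.sub_apply]
      ring
    · have := integrable_mul_of_tsupport_subset hfl
        (hφ.continuous.mul (contDiff_fderiv_apply_const (hψ n) e).continuous)
        hc.mul_right (tsupport_mul_subset_left.trans hs)
      refine this.congr (Eventually.of_forall fun z => ?_)
      simp only [Pi.mul_apply]
      ring
  have hlim : ∀ g : C2 → ℝ, Integrable g →
      Tendsto (fun n => ∫ z, (1 - ψ n z) * g z) atTop (𝓝 (∫ z, g z)) := by
    intro g hg
    refine tendsto_integral_of_dominated_convergence (fun z => ‖g z‖)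
      (fun n => (continuous_const.sub (hψ n).continuous).aestronglyMeasurable.mul hg.1) hg.norm
      (fun n => Eventually.of_forall fun z => ?_) ?_
    · have := hψ01 n z
      rw [norm_mul]
      refine mul_le_of_le_one_left (norm_nonneg _) ?_
      rw [Real.norm_eq_abs, abs_le]
      constructor <;> linarith
    · filter_upwards [hne] with z hz
      refine tendsto_const_nhds.congr' ?_
      filter_upwards [hψlim z hz] with n hn
      simp [hn]
  -- the error term tends to zero, since it is dominated by the integral over a ball `B n` of
  -- `|f φ| n ≤ |f φ|² + n²`
  have herr : Tendsto (fun n => ∫ z, (f z * φ z) * fderiv ℝ (ψ n) z e) atTop (𝓝 0) := by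
    have hF : Integrable fun z => (f z * φ z) ^ 2 := by
      have hsq : IntegrableOn (fun z => ‖f z‖ ^ 2) W := (memLp_two_iff_integrable_sq_norm h1.1).1 h1
      have := integrable_mul_of_tsupport_subset (ψ := fun z => φ z ^ 2) hsq.locallyIntegrableOn
        (hφ.continuous.pow 2) (by simp only [pow_two]; exact hc.mul_left)
        (by simpa only [pow_two] using (tsupport_mul_subset_left (f := φ) (g := φ)).trans hs)
      refine this.congr (Eventually.of_forall fun z => ?_)
      simp [mul_pow]
    let B : ℕ → Set C2 := fun n => Metric.closedBall 0 (2 / ((n : ℝ) + 1))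
    have hB : ∀ n, MeasurableSet (B n) := fun n => measurableSet_closedBall
    have hBt : ∀ n, volume (B n) < ⊤ := fun n => measure_closedBall_lt_top
    have hl1 : Tendsto (fun n => ∫ z in B n, (f z * φ z) ^ 2) atTop (𝓝 0) := by
      simp only [← integral_indicator (hB _)]
      have : Tendsto (fun n => ∫ z, (B n).indicator (fun z => (f z * φ z) ^ 2) z) atTop
          (𝓝 (∫ _ : C2, (0 : ℝ))) := by
        refine tendsto_integral_of_dominated_convergence (fun z => (f z * φ z) ^ 2)
          (fun n => hF.1.indicator (hB n)) hF (fun n => Eventually.of_forall fun z => ?_) ?_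
        · rw [Real.norm_of_nonneg (Set.indicator_nonneg (fun _ _ => sq_nonneg _) _)]
          exact Set.indicator_le_self' (fun _ _ => sq_nonneg _) _
        · filter_upwards [hne] with z hz
          have hz' : 0 < ‖z‖ := norm_pos_iff.2 hz
          refine tendsto_const_nhds.congr' ?_
          have : Tendsto (fun n : ℕ => 2 / ((n : ℝ) + 1)) atTop (𝓝 0) := by
            simpa [div_eq_mul_inv] using
              (tendsto_one_div_add_atTop_nhds_zero_nat (𝕜 := ℝ)).const_mul 2
          filter_upwards [this.eventually_lt_const hz'] with n hn
          rw [Set.indicator_of_notMem]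
          simpa [B] using hn
      simpa using this
    have hl2 : Tendsto (fun n : ℕ => |C| * ((∫ z in B n, (f z * φ z) ^ 2) +
        ((n : ℝ) + 1) ^ 2 * (volume : Measure C2).real (B n))) atTop (𝓝 0) := by
      simpa using (hl1.add tendsto_sq_mul_measure_closedBall).const_mul |C|
    refine squeeze_zero_norm (fun n => ?_) hl2
    have h10 : ∫ z, (f z * φ z) * fderiv ℝ (ψ n) z e =
        ∫ z in B n, (f z * φ z) * fderiv ℝ (ψ n) z e := by
      rw [← integral_indicator (hB n)]
      congr 1
      ext z
      by_cases hz : z ∈ B n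
      · simp [hz]
      · rw [Set.indicator_of_notMem hz, hψz n z hz, mul_zero]
    have hint : IntegrableOn (fun z => (f z * φ z) ^ 2 + ((n : ℝ) + 1) ^ 2) (B n) :=
      hF.integrableOn.add (integrableOn_const (hBt n).ne)
    have h11 : |C| * ((∫ z in B n, (f z * φ z) ^ 2) +
        ((n : ℝ) + 1) ^ 2 * (volume : Measure C2).real (B n)) =
        ∫ z in B n, |C| * ((f z * φ z) ^ 2 + ((n : ℝ) + 1) ^ 2) := by
      rw [integral_const_mul, integral_add hF.integrableOn (integrableOn_const (hBt n).ne)]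
      simp [mul_comm]
    rw [h10, h11]
    refine norm_integral_le_of_norm_le (hint.const_mul _) (Eventually.of_forall fun z => ?_)
    rw [hψd, norm_mul, norm_mul ((n : ℝ) + 1),
      Real.norm_of_nonneg (by positivity : (0 : ℝ) ≤ (n : ℝ) + 1)]
    have h12 : ‖fderiv ℝ β (((n : ℝ) + 1) • z) e‖ ≤ |C| := (hC _).trans (le_abs_self C)
    have h13 : ‖f z * φ z‖ * ((n : ℝ) + 1) ≤ (f z * φ z) ^ 2 + ((n : ℝ) + 1) ^ 2 := by
      rw [← sq_abs (f z * φ z), Real.norm_eq_abs]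
      nlinarith [sq_nonneg (|f z * φ z| - ((n : ℝ) + 1)), sq_nonneg (|f z * φ z|),
        sq_nonneg ((n : ℝ) + 1)]
    calc ‖f z * φ z‖ * (((n : ℝ) + 1) * ‖fderiv ℝ β (((n : ℝ) + 1) • z) e‖)
        = ‖fderiv ℝ β (((n : ℝ) + 1) • z) e‖ * (‖f z * φ z‖ * ((n : ℝ) + 1)) := by ring
      _ ≤ |C| * ((f z * φ z) ^ 2 + ((n : ℝ) + 1) ^ 2) := by gcongr
  have hL := (hlim _ (integrable_mul_fderiv hfl hφ hc hs e)).sub herr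
  have hR := (hlim _ (integrable_clm_mul hGl hφ.continuous hc hs e)).neg
  simp only [hid, sub_zero] at hL
  exact tendsto_nhds_unique hL hR

/-! ### Weyl's lemma for the partial Laplacians -/

/-- The Laplacian of `φ` in the `j`-th complex variable. -/
def partialLaplacian (j : Fin 2) (φ : C2 → ℝ) (z : C2) : ℝ :=
  fderiv ℝ (fun w => fderiv ℝ φ w (basisVec j)) z (basisVec j) +
    fderiv ℝ (fun w => fderiv ℝ φ w (Complex.I • basisVec j)) z (Complex.I • basisVec j)

section weyl

open InnerProductSpace ContinuousLinearMap Convolution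

/-- Integral of a radial kernel against a harmonic function, in polar coordinates. -/
lemma integral_radial_mul_of_harmonic_aux {G : ℂ → ℝ} (hGc : Continuous G) {r : ℝ} (hr : 0 < r)
    {b : ℝ → ℝ} (hbc : Continuous b) (hb : ∀ x, r ^ 2 ≤ x → b x = 0) {z : ℂ}
    (hG : HarmonicOnNhd G (Metric.closedBall z r)) :
    ∫ w, b (‖w‖ ^ 2) * G (z - w) = ∫ s in Set.Ioi (0 : ℝ), s * b (s ^ 2) * (2 * Real.pi * G z) := by
  have hmean : ∀ s : ℝ, 0 < s → s ≤ r →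
      ∫ θ in Set.Ioo (-Real.pi) Real.pi, G (z - Complex.polarCoord.symm (s, θ)) =
        2 * Real.pi * G z := by
    intro s hs hsr
    -- the circle is `θ ↦ z - s e^{iθ}`, hence the negative radius
    have h1 : Real.circleAverage G z (-s) = G z := by
      refine InnerProductSpace.HarmonicOnNhd.circleAverage_eq (hG.mono ?_)
      rw [abs_neg, abs_of_pos hs]
      exact Metric.closedBall_subset_closedBall hsr
    have hper : Function.Periodic (fun θ => G (circleMap z (-s) θ)) (2 * Real.pi) := fun θ => by
      simp [periodic_circleMap z (-s) θ]
    have h2 := hper.intervalIntegral_add_eq (-Real.pi) 0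
    rw [show -Real.pi + 2 * Real.pi = Real.pi by ring, zero_add] at h2
    rw [Real.circleAverage, ← h2, smul_eq_mul, inv_mul_eq_iff_eq_mul₀ (by positivity)] at h1
    rw [← h1, intervalIntegral.integral_of_le (by linarith [Real.pi_pos]),
      integral_Ioc_eq_integral_Ioo]
    congr 1
    ext θ
    rw [Complex.polarCoord_symm_apply, circleMap, Complex.exp_mul_I]
    simp only [← Complex.ofReal_cos, ← Complex.ofReal_sin]
    congr 1
    push_cast
    ring
  rw [← Complex.integral_comp_polarCoord_symm, polarCoord_target, Measure.volume_eq_prod,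
    setIntegral_prod]
  · refine setIntegral_congr_fun measurableSet_Ioi fun s hs => ?_
    have hs' : (0 : ℝ) < s := hs
    simp only [Complex.norm_polarCoord_symm, sq_abs, smul_eq_mul, ← mul_assoc]
    rw [integral_const_mul]
    rcases le_total s r with h | h
    · rw [hmean s hs' h]
      ring
    · rw [hb (s ^ 2) (by gcongr)]
      simp
  · have hcont : Continuous fun p : ℝ × ℝ => p.1 •
        (b (‖Complex.polarCoord.symm p‖ ^ 2) * G (z - Complex.polarCoord.symm p)) := by
      simp only [Complex.polarCoord_symm_apply]
      fun_prop
    rw [← Measure.volume_eq_prod]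
    have h1 : IntegrableOn (fun p : ℝ × ℝ => p.1 •
        (b (‖Complex.polarCoord.symm p‖ ^ 2) * G (z - Complex.polarCoord.symm p)))
        (Set.Icc 0 r ×ˢ Set.Icc (-Real.pi) Real.pi) :=
      hcont.continuousOn.integrableOn_compact (isCompact_Icc.prod isCompact_Icc)
    refine h1.of_forall_sdiff_eq_zero (measurableSet_Ioi.prod measurableSet_Ioo) ?_
    rintro ⟨s, θ⟩ ⟨⟨hs, hθ⟩, hn⟩
    have hs' : (0 : ℝ) < s := hs
    have hrs : r < s := by
      by_contra! h
      exact hn ⟨⟨hs'.le, h⟩, Set.Ioo_subset_Icc_self hθ⟩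
    simp only [Complex.norm_polarCoord_symm, sq_abs]
    rw [hb (s ^ 2) (by gcongr)]
    simp

/-- The mean value property of harmonic functions, with a radial weight. -/
lemma integral_radial_mul_of_harmonic {G : ℂ → ℝ} (hGc : Continuous G) {r : ℝ} (hr : 0 < r)
    {b : ℝ → ℝ} (hbc : Continuous b) (hb : ∀ x, r ^ 2 ≤ x → b x = 0) {z : ℂ}
    (hG : HarmonicOnNhd G (Metric.closedBall z r)) :
    ∫ w, b (‖w‖ ^ 2) * G (z - w) = (∫ w : ℂ, b (‖w‖ ^ 2)) * G z := by
  have h1 := integral_radial_mul_of_harmonic_aux hGc hr hbc hb hG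
  have h2 := integral_radial_mul_of_harmonic_aux (G := fun _ => 1) continuous_const hr hbc hb
    (z := z) (harmonicOnNhd_const 1)
  simp only [mul_one] at h2
  rw [h1, h2, ← integral_mul_const]
  refine integral_congr_ae (Eventually.of_forall fun s => ?_)
  ring

/-- A smooth function on `ℂ²` with vanishing second derivative along `L 1` plus that along `L I` is
harmonic along the affine complex line parametrized by `L`. -/
lemma harmonicAt_comp_affine {g : C2 → ℝ} (hg : ContDiff ℝ (⊤ : ℕ∞) g) (L : ℂ →L[ℝ] C2) (a : C2)
    {ζ : ℂ} (h : ∀ᶠ ξ in 𝓝 ζ, fderiv ℝ (fun w => fderiv ℝ g w (L 1)) (a + L ξ) (L 1) +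
      fderiv ℝ (fun w => fderiv ℝ g w (L Complex.I)) (a + L ξ) (L Complex.I) = 0) :
    HarmonicAt (fun ξ => g (a + L ξ)) ζ := by
  have hA : ∀ ξ, HasFDerivAt (fun ξ => a + L ξ) L ξ := fun ξ => (L.hasFDerivAt).const_add a
  have hA' : ContDiff ℝ (⊤ : ℕ∞) fun ξ => a + L ξ := contDiff_const.add L.contDiff
  have h1 : ∀ k : C2 → ℝ, ContDiff ℝ (⊤ : ℕ∞) k → ∀ ξ v,
      fderiv ℝ (fun ξ => k (a + L ξ)) ξ v = fderiv ℝ k (a + L ξ) (L v) := by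
    intro k hk ξ v
    have := ((hk.differentiable (by simp) (a + L ξ)).hasFDerivAt.comp ξ (hA ξ)).fderiv
    change fderiv ℝ (k ∘ fun ξ => a + L ξ) ξ v = _
    rw [this]
    rfl
  have hG : ContDiff ℝ (⊤ : ℕ∞) fun ξ => g (a + L ξ) := hg.comp hA'
  refine ⟨(hG.of_le (by norm_cast)).contDiffAt, ?_⟩
  filter_upwards [h] with ξ hξ
  rw [laplacian_eq_iteratedFDeriv_complexPlane]
  have h2 : ∀ v, iteratedFDeriv ℝ 2 (fun ξ => g (a + L ξ)) ξ ![v, v] =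
      fderiv ℝ (fun w => fderiv ℝ g w (L v)) (a + L ξ) (L v) := by
    intro v
    rw [iteratedFDeriv_two_apply]
    simp only [Matrix.cons_val_zero, Matrix.cons_val_one]
    have h3 : DifferentiableAt ℝ (fderiv ℝ fun ξ => g (a + L ξ)) ξ :=
      (hG.fderiv_right (m := (⊤ : ℕ∞)) (by simp)).differentiable (by simp) ξ
    have h4 : fderiv ℝ (fun ξ' => fderiv ℝ (fun ξ => g (a + L ξ)) ξ' v) ξ v =
        fderiv ℝ (fderiv ℝ fun ξ => g (a + L ξ)) ξ v v := by
      rw [fderiv_clm_apply h3 (differentiableAt_const v)]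
      simp
    rw [← h4]
    simp only [h1 g hg]
    exact h1 _ (contDiff_fderiv_apply_const hg _) ξ v
  simpa only [h2, Pi.zero_apply] using hξ

/-- The mean value property on bidiscs of functions that are harmonic in each variable. -/
lemma integral_biradial_mul {g : C2 → ℝ} (hg : ContDiff ℝ (⊤ : ℕ∞) g) {p z : C2} {r : ℝ}
    (hr : 0 < r) (hΔ : ∀ j, ∀ w ∈ Metric.ball p (2 * r), partialLaplacian j g w = 0)
    (hz : z ∈ Metric.ball p r) {b : ℝ → ℝ} (hbc : Continuous b)
    (hb : ∀ x, r ^ 2 ≤ x → b x = 0) :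
    ∫ w : C2, b (‖w.1‖ ^ 2) * b (‖w.2‖ ^ 2) * g (z - w) = (∫ w : ℂ, b (‖w‖ ^ 2)) ^ 2 * g z := by
  obtain ⟨p₁, p₂⟩ := p
  obtain ⟨z₁, z₂⟩ := z
  have hz' : dist z₁ p₁ < r ∧ dist z₂ p₂ < r := by
    simpa [Prod.dist_eq] using hz
  have hgc := hg.continuous
  have hsupp : ∀ w : ℂ, r ≤ ‖w‖ → b (‖w‖ ^ 2) = 0 := fun w hw => hb _ (by gcongr)
  have hcs : HasCompactSupport fun w : C2 => b (‖w.1‖ ^ 2) * b (‖w.2‖ ^ 2) * g ((z₁, z₂) - w) := by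
    refine HasCompactSupport.intro (isCompact_closedBall (0 : C2) r) fun w hw => ?_
    have : r < ‖w.1‖ ∨ r < ‖w.2‖ := by
      by_contra! h
      exact hw (by simpa [Prod.norm_def] using h)
    rcases this with h | h <;> simp [hsupp _ h.le]
  have hint : Integrable fun w : C2 => b (‖w.1‖ ^ 2) * b (‖w.2‖ ^ 2) * g ((z₁, z₂) - w) :=
    Continuous.integrable_of_hasCompactSupport (by fun_prop) hcs
  rw [Measure.volume_eq_prod] at hint ⊢
  have inner : ∀ w₁ : ℂ, ∫ w₂ : ℂ, b (‖w₁‖ ^ 2) * b (‖w₂‖ ^ 2) * g ((z₁, z₂) - (w₁, w₂)) =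
      (∫ w : ℂ, b (‖w‖ ^ 2)) * (b (‖w₁‖ ^ 2) * g (z₁ - w₁, z₂)) := by
    intro w₁
    by_cases hw : r ≤ ‖w₁‖
    · simp [hsupp _ hw]
    · push Not at hw
      have := integral_radial_mul_of_harmonic (G := fun ζ => g (z₁ - w₁, ζ)) (by fun_prop) hr hbc hb
        (z := z₂) ?_
      · simp only [mul_assoc, Prod.mk_sub_mk]
        rw [integral_const_mul, this]
        ring
      · intro ζ hζ
        have := harmonicAt_comp_affine hg (ContinuousLinearMap.inr ℝ ℂ ℂ) (z₁ - w₁, 0) (ζ := ζ) ?_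
        · simpa using this
        · have hopen : ∀ᶠ ξ in 𝓝 ζ, ((z₁ - w₁, ξ) : C2) ∈ Metric.ball (p₁, p₂) (2 * r) := by
            refine (Metric.isOpen_ball.preimage (by fun_prop :
              Continuous fun ξ => ((z₁ - w₁, ξ) : C2))).mem_nhds ?_
            have h5 : dist (z₁ - w₁) p₁ < 2 * r := by
              calc dist (z₁ - w₁) p₁ ≤ dist (z₁ - w₁) z₁ + dist z₁ p₁ := dist_triangle _ _ _
                _ < 2 * r := by rw [dist_self_sub_left]; linarith [hz'.1]
            have h6 : dist ζ p₂ < 2 * r := by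
              calc dist ζ p₂ ≤ dist ζ z₂ + dist z₂ p₂ := dist_triangle _ _ _
                _ < 2 * r := by linarith [hz'.2, Metric.mem_closedBall.1 hζ]
            exact max_lt h5 h6
          filter_upwards [hopen] with ξ hξ
          simpa [partialLaplacian, basisVec] using hΔ 1 _ hξ
  rw [integral_prod _ hint, integral_congr_ae (Eventually.of_forall inner), integral_const_mul,
    integral_radial_mul_of_harmonic (G := fun ζ => g (ζ, z₂)) (by fun_prop) hr
    hbc hb (z := z₁)]
  · ring
  · intro ζ hζ
    have := harmonicAt_comp_affine hg (ContinuousLinearMap.inl ℝ ℂ ℂ) (0, z₂) (ζ := ζ) ?_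
    · simpa using this
    · have hopen : ∀ᶠ ξ in 𝓝 ζ, ((ξ, z₂) : C2) ∈ Metric.ball (p₁, p₂) (2 * r) := by
        refine (Metric.isOpen_ball.preimage (by fun_prop :
          Continuous fun ξ => ((ξ, z₂) : C2))).mem_nhds ?_
        have h6 : dist ζ p₁ < 2 * r := by
          calc dist ζ p₁ ≤ dist ζ z₁ + dist z₁ p₁ := dist_triangle _ _ _
            _ < 2 * r := by linarith [hz'.1, Metric.mem_closedBall.1 hζ]
        have h7 : dist z₂ p₂ < 2 * r := by linarith [hz'.2]
        simp [Prod.dist_eq, h6, h7]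
      filter_upwards [hopen] with ξ hξ
      simpa [partialLaplacian, basisVec] using hΔ 0 _ hξ

lemma convolution_left_comm {η ρ k : C2 → ℝ} (hη : Continuous η) (hηc : HasCompactSupport η)
    (hρ : Continuous ρ) (hρc : HasCompactSupport ρ) (hk : Integrable k) (z : C2) :
    (ρ ⋆[lsmul ℝ ℝ] (η ⋆[lsmul ℝ ℝ] k)) z = (η ⋆[lsmul ℝ ℝ] (ρ ⋆[lsmul ℝ ℝ] k)) z := by
  have key : ∀ {η ρ : C2 → ℝ}, Continuous η → HasCompactSupport η → Continuous ρ →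
      HasCompactSupport ρ → ((ρ ⋆[lsmul ℝ ℝ] η) ⋆[lsmul ℝ ℝ] k) z =
        (ρ ⋆[lsmul ℝ ℝ] (η ⋆[lsmul ℝ ℝ] k)) z := by
    intro η ρ hη hηc hρ hρc
    refine convolution_assoc (lsmul ℝ ℝ) (lsmul ℝ ℝ) (lsmul ℝ ℝ) (lsmul ℝ ℝ)
      (fun x y z => by simp [mul_assoc]) hρ.aestronglyMeasurable hη.aestronglyMeasurable
      hk.aestronglyMeasurable (Eventually.of_forall fun y => ?_)
      (Eventually.of_forall fun y => ?_) ?_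
    · exact hρc.convolutionExists_left _ hρ hη.locallyIntegrable y
    · exact hηc.norm.convolutionExists_left _ hη.norm hk.norm.locallyIntegrable y
    · exact hρc.norm.convolutionExists_left _ hρ.norm
        (hηc.norm.continuous_convolution_left _ hη.norm
          hk.norm.locallyIntegrable).locallyIntegrable z
  rw [← key hη hηc hρ hρc, ← key hρ hρc hη hηc]
  congr 1
  rw [← convolution_flip]
  congr 1
  refine ContinuousLinearMap.ext fun x => ContinuousLinearMap.ext fun y => ?_
  simp [mul_comm]

lemma fderiv_convolution_apply {ρ k : C2 → ℝ} (hρ : ContDiff ℝ (⊤ : ℕ∞) ρ)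
    (hρc : HasCompactSupport ρ) (hk : LocallyIntegrable k) (z e : C2) :
    fderiv ℝ (ρ ⋆[lsmul ℝ ℝ] k) z e = ((fun x => fderiv ℝ ρ x e) ⋆[lsmul ℝ ℝ] k) z := by
  have hflip : ∀ ρ : C2 → ℝ, ρ ⋆[lsmul ℝ ℝ] k = k ⋆[(lsmul ℝ ℝ).flip] ρ := fun ρ =>
    (convolution_flip _).symm
  rw [hflip, hflip,
    (hρc.hasFDerivAt_convolution_right (lsmul ℝ ℝ).flip hk (hρ.of_le (by simp)) z).fderiv]
  exact convolution_precompR_apply (lsmul ℝ ℝ).flip hk (hρc.fderiv ℝ)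
    (hρ.continuous_fderiv (by simp)) z e

lemma partialLaplacian_convolution {ρ k : C2 → ℝ} (hρ : ContDiff ℝ (⊤ : ℕ∞) ρ)
    (hρc : HasCompactSupport ρ) (hk : LocallyIntegrable k) (j : Fin 2) (z : C2) :
    partialLaplacian j (ρ ⋆[lsmul ℝ ℝ] k) z = ∫ t, partialLaplacian j ρ (z - t) * k t := by
  have h1 : ∀ e, (fun w => fderiv ℝ (ρ ⋆[lsmul ℝ ℝ] k) w e) =
      (fun x => fderiv ℝ ρ x e) ⋆[lsmul ℝ ℝ] k := fun e =>
    funext fun w => fderiv_convolution_apply hρ hρc hk w e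
  have h2 : ∀ e, fderiv ℝ (fun w => fderiv ℝ (ρ ⋆[lsmul ℝ ℝ] k) w e) z e =
      ∫ t, fderiv ℝ (fun x => fderiv ℝ ρ x e) (z - t) e * k t := by
    intro e
    rw [h1, fderiv_convolution_apply (contDiff_fderiv_apply_const hρ e)
      (hasCompactSupport_fderiv_apply_const hρc e) hk, convolution_eq_swap]
    simp
  have h3 : ∀ e, Integrable fun t => fderiv ℝ (fun x => fderiv ℝ ρ x e) (z - t) e * k t := by
    intro e
    have := (hasCompactSupport_fderiv_apply_const (hasCompactSupport_fderiv_apply_const hρc e)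
      e).convolutionExists_left (lsmul ℝ ℝ)
      (contDiff_fderiv_apply_const (contDiff_fderiv_apply_const hρ e) e).continuous hk z
    simpa using this.integrable_swap
  simp only [partialLaplacian, h2, add_mul]
  rw [integral_add (h3 _) (h3 _)]

lemma partialLaplacian_comp_sub {ρ : C2 → ℝ} (hρ : ContDiff ℝ (⊤ : ℕ∞) ρ) (j : Fin 2) (z t : C2) :
    partialLaplacian j (fun t => ρ (z - t)) t = partialLaplacian j ρ (z - t) := by
  have h : ∀ (k : C2 → ℝ), ContDiff ℝ (⊤ : ℕ∞) k → ∀ t e : C2,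
      fderiv ℝ (fun t => k (z - t)) t e = - fderiv ℝ k (z - t) e := by
    intro k hk t e
    have h1 : HasFDerivAt (fun t : C2 => z - t) (-ContinuousLinearMap.id ℝ C2) t :=
      (hasFDerivAt_id t).const_sub z
    have h2 := ((hk.differentiable (by simp) (z - t)).hasFDerivAt.comp t h1).fderiv
    change fderiv ℝ (k ∘ fun t => z - t) t e = _
    rw [h2]
    simp
  have h' : ∀ e, fderiv ℝ (fun w => fderiv ℝ (fun t => ρ (z - t)) w e) t e =
      fderiv ℝ (fun w => fderiv ℝ ρ w e) (z - t) e := by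
    intro e
    simp only [h ρ hρ]
    rw [fderiv_fun_neg, neg_apply, h _ (contDiff_fderiv_apply_const hρ e), neg_neg]
  simp only [partialLaplacian, h']

/-- **Weyl's lemma**: a locally integrable function whose partial Laplacians vanish in the sense of
distributions is, locally, almost everywhere equal to a smooth function.

Let `k` be the function cut off by a ball, let `ρ n` be mollifiers, and let `η` be a product of
radial bumps in the two variables, with integral `c`. Since `ρ n ⋆ k` is harmonic in each variable,
the mean value property gives `ρ n ⋆ (η ⋆ k) = η ⋆ (ρ n ⋆ k) = c (ρ n ⋆ k)`, and in the limit
`η ⋆ k = c k` almost everywhere. -/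
theorem exists_contDiff_ae_eq_of_integral_partialLaplacian_eq_zero {h : C2 → ℝ} {U : Set C2}
    (hU : IsOpen U) (hl : LocallyIntegrableOn h U)
    (hh : ∀ (j : Fin 2) (φ : C2 → ℝ), ContDiff ℝ (⊤ : ℕ∞) φ → HasCompactSupport φ →
      tsupport φ ⊆ U → ∫ z, h z * partialLaplacian j φ z = 0) {p : C2} (hp : p ∈ U) :
    ∃ W : Set C2, IsOpen W ∧ p ∈ W ∧ ∃ g : C2 → ℝ, ContDiff ℝ (⊤ : ℕ∞) g ∧
      h =ᵐ[volume.restrict W] g := by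
  obtain ⟨R, hR, hRU⟩ := Metric.nhds_basis_closedBall.mem_iff.1 (hU.mem_nhds hp)
  obtain ⟨r, hr, rfl⟩ : ∃ r, 0 < r ∧ R = 3 * r := ⟨R / 3, by positivity, by ring⟩
  let K := Metric.closedBall p (3 * r)
  let k : C2 → ℝ := K.indicator h
  have hkint : Integrable k :=
    (integrable_indicator_iff measurableSet_closedBall).2
      (hl.integrableOn_compact_subset hRU (isCompact_closedBall _ _))
  have hk : LocallyIntegrable k := hkint.locallyIntegrable
  let b : ContDiffBump (0 : ℝ) := ⟨r ^ 2 / 2, r ^ 2, by positivity, by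
    have : 0 < r ^ 2 := by positivity
    linarith⟩
  have hb : ∀ x, r ^ 2 ≤ x → b x = 0 := by
    intro x hx
    refine b.zero_of_le_dist ?_
    rw [dist_zero_right]
    exact hx.trans (Real.le_norm_self x)
  let η : C2 → ℝ := fun w => b (‖w.1‖ ^ 2) * b (‖w.2‖ ^ 2)
  have hη : ContDiff ℝ (⊤ : ℕ∞) η := by
    have h1 : ContDiff ℝ (⊤ : ℕ∞) fun w : ℂ => b (‖w‖ ^ 2) := b.contDiff.comp (contDiff_norm_sq ℝ)
    exact (h1.comp contDiff_fst).mul (h1.comp contDiff_snd)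
  have hηc : HasCompactSupport η := by
    refine HasCompactSupport.intro (isCompact_closedBall (0 : C2) r) fun w hw => ?_
    have : r < ‖w.1‖ ∨ r < ‖w.2‖ := by
      by_contra! h
      exact hw (by simpa [Prod.norm_def] using h)
    rcases this with h | h
    · simp [η, hb (‖w.1‖ ^ 2) (by gcongr)]
    · simp [η, hb (‖w.2‖ ^ 2) (by gcongr)]
  let c : ℝ := (∫ w : ℂ, b (‖w‖ ^ 2)) ^ 2
  have hc : c ≠ 0 := by
    refine pow_ne_zero _ (ne_of_gt ?_)
    have hcont : Continuous fun w : ℂ => b (‖w‖ ^ 2) := b.continuous.comp (by fun_prop)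
    refine hcont.integral_pos_of_hasCompactSupport_nonneg_nonzero ?_ (fun w => b.nonneg)
      (x := 0) ?_
    · refine HasCompactSupport.intro (isCompact_closedBall (0 : ℂ) r) fun w hw => ?_
      have : r < ‖w‖ := by simpa using hw
      exact hb _ (by gcongr)
    · have : b (‖(0 : ℂ)‖ ^ 2) = 1 := b.one_of_mem_closedBall (by
        simp [b]; positivity)
      rw [this]
      exact one_ne_zero
  let ρ : ℕ → ContDiffBump (0 : C2) := fun n => ⟨r / (n + 1) / 2, r / (n + 1), by positivity, by
    have : 0 < r / ((n : ℝ) + 1) := by positivity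
    linarith⟩
  have hρlim : Tendsto (fun n => (ρ n).rOut) atTop (𝓝 0) := by
    simpa [ρ, div_eq_mul_inv] using
      (tendsto_one_div_add_atTop_nhds_zero_nat (𝕜 := ℝ)).const_mul r
  have hρs : ∀ n, ContDiff ℝ (⊤ : ℕ∞) ((ρ n).normed volume) := fun n => (ρ n).contDiff_normed
  have hρc : ∀ n, HasCompactSupport ((ρ n).normed (volume : Measure C2)) := fun n =>
    (ρ n).hasCompactSupport_normed
  have hρr : ∀ n, (ρ n).rOut ≤ r := by
    intro n
    refine div_le_self hr.le ?_
    have : (0 : ℝ) ≤ n := by positivity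
    linarith
  -- the regularizations of `k` are harmonic in each variable near `p`
  have hharm : ∀ n j, ∀ z ∈ Metric.ball p (2 * r),
      partialLaplacian j ((ρ n).normed volume ⋆[lsmul ℝ ℝ] k) z = 0 := by
    intro n j z hz
    rw [partialLaplacian_convolution (hρs n) (hρc n) hk]
    let φ : C2 → ℝ := fun t => (ρ n).normed volume (z - t)
    have hφK : tsupport φ ⊆ K := by
      refine closure_minimal (fun t ht => ?_) Metric.isClosed_closedBall
      have h1 : z - t ∈ Function.support ((ρ n).normed (volume : Measure C2)) := ht
      rw [(ρ n).support_normed_eq, mem_ball_zero_iff] at h1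
      have h2 : dist z p < 2 * r := hz
      have h3 : dist t z < r := by
        rw [dist_comm, dist_eq_norm]
        exact h1.trans_le (hρr n)
      exact (dist_triangle t z p).trans (by linarith)
    have hφs : ContDiff ℝ (⊤ : ℕ∞) φ := (hρs n).comp (contDiff_const.sub contDiff_id)
    have hφc : HasCompactSupport φ :=
      (isCompact_closedBall p (3 * r)).of_isClosed_subset (isClosed_tsupport _) hφK
    rw [← hh j φ hφs hφc (hφK.trans hRU)]
    refine integral_congr_ae (Eventually.of_forall fun t => ?_)
    simp only
    rw [← partialLaplacian_comp_sub (hρs n)]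
    change partialLaplacian j φ t * k t = _
    by_cases ht : t ∈ K
    · simp only [k, Set.indicator_of_mem ht]
      ring
    · have h0 : ∀ e, fderiv ℝ (fun w => fderiv ℝ φ w e) t e = 0 := fun e =>
        image_eq_zero_of_notMem_tsupport (f := fun t => fderiv ℝ (fun w => fderiv ℝ φ w e) t e)
          fun h => ht (hφK (tsupport_fderiv_apply_const_subset _ e
            (tsupport_fderiv_apply_const_subset _ e h)))
      simp [partialLaplacian, h0]
  have hmean : ∀ n, ∀ z ∈ Metric.ball p r,
      ((ρ n).normed volume ⋆[lsmul ℝ ℝ] (η ⋆[lsmul ℝ ℝ] k)) z =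
        c * ((ρ n).normed volume ⋆[lsmul ℝ ℝ] k) z := by
    intro n z hz
    rw [convolution_left_comm hη.continuous hηc (hρs n).continuous (hρc n) hkint, convolution_def]
    exact integral_biradial_mul ((hρc n).contDiff_convolution_left _ (hρs n) hk) hr (hharm n) hz
      b.continuous hb
  refine ⟨Metric.ball p r, Metric.isOpen_ball, Metric.mem_ball_self hr,
    fun z => c⁻¹ * (η ⋆[lsmul ℝ ℝ] k) z,
    contDiff_const.mul (hηc.contDiff_convolution_left _ hη hk), ?_⟩
  have hae := ContDiffBump.ae_convolution_tendsto_right_of_locallyIntegrable (μ := volume)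
    (φ := ρ) (K := 2) hρlim (Eventually.of_forall fun n => by simp [ρ]; linarith) hk
  rw [Filter.EventuallyEq, ae_restrict_iff' Metric.isOpen_ball.measurableSet]
  filter_upwards [hae] with z hz hzp
  have h1 := ContDiffBump.convolution_tendsto_right_of_continuous (μ := volume) hρlim
    (hηc.continuous_convolution_left (lsmul ℝ ℝ) hη.continuous hk) z
  simp only [hmean _ z hzp] at h1
  have h2 := tendsto_nhds_unique h1 (hz.const_mul c)
  have h3 : k z = h z := Set.indicator_of_mem
    (Metric.ball_subset_closedBall (Metric.ball_subset_ball (by linarith) hzp)) h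
  rw [h2, h3, inv_mul_cancel_left₀ hc]

end weyl

/-! ### The logarithm of a coordinate -/

lemma locallyIntegrable_comp_fst {f : ℂ → ℝ} (hf : LocallyIntegrable f) :
    LocallyIntegrable fun z : C2 => f z.1 := by
  rw [locallyIntegrable_iff]
  intro K hK
  obtain ⟨R, hR⟩ := hK.isBounded.subset_closedBall 0
  refine IntegrableOn.mono_set (t := Metric.closedBall (0 : ℂ) R ×ˢ Metric.closedBall (0 : ℂ) R) ?_
    (by rw [closedBall_prod_same]; exact hR)
  have : IsFiniteMeasure ((volume : Measure ℂ).restrict (Metric.closedBall 0 R)) :=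
    ⟨by simpa using (isCompact_closedBall (0 : ℂ) R).measure_lt_top (μ := volume)⟩
  rw [IntegrableOn, Measure.volume_eq_prod, ← Measure.prod_restrict]
  exact Integrable.comp_fst (hf.integrableOn_isCompact (isCompact_closedBall _ _)) _

lemma locallyIntegrable_inv_norm_add_norm_fst :
    LocallyIntegrable fun z : C2 => ‖z.1‖⁻¹ + ‖z.1‖ := by
  refine locallyIntegrable_comp_fst (f := fun s => ‖s‖⁻¹ + ‖s‖) ?_
  refine LocallyIntegrable.add ?_ continuous_norm.locallyIntegrable
  refine locallyIntegrable_of_norm_le_rpow (C := 1) (α := 1) (by simp) (by simp)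
    (Eventually.of_forall fun x => ?_) (by fun_prop)
  simp [Real.rpow_neg_one]

lemma abs_log_norm_le (s : ℂ) : |Real.log ‖s‖| ≤ ‖s‖⁻¹ + ‖s‖ := by
  rcases eq_or_ne s 0 with rfl | hs
  · simp
  · have h : 0 < ‖s‖ := norm_pos_iff.2 hs
    have h1 := Real.log_le_sub_one_of_pos h
    have h2 := Real.one_sub_inv_le_log_of_pos h
    have h3 := inv_pos.2 h
    rw [abs_le]
    constructor <;> linarith

lemma locallyIntegrable_log_norm_fst : LocallyIntegrable fun z : C2 => Real.log ‖z.1‖ := by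
  refine locallyIntegrable_inv_norm_add_norm_fst.mono
    (Real.measurable_log.comp (by fun_prop)).aestronglyMeasurable
    (Eventually.of_forall fun z => ?_)
  rw [Real.norm_eq_abs]
  exact (abs_log_norm_le z.1).trans (le_abs_self _)

/-- The regularization `log (|s|² + δ) / 2` of `log |s|`. -/
def regLog (δ : ℝ) (z : C2) : ℝ := Real.log (z.1.re ^ 2 + z.1.im ^ 2 + δ) / 2

section regLog

variable {δ : ℝ}

lemma regLog_denom_pos (hδ : 0 < δ) (z : C2) : 0 < z.1.re ^ 2 + z.1.im ^ 2 + δ := by positivity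

lemma contDiff_re_fst : ContDiff ℝ (⊤ : ℕ∞) fun z : C2 => z.1.re :=
  Complex.reCLM.contDiff.comp contDiff_fst

lemma contDiff_im_fst : ContDiff ℝ (⊤ : ℕ∞) fun z : C2 => z.1.im :=
  Complex.imCLM.contDiff.comp contDiff_fst

lemma contDiff_regLog (hδ : 0 < δ) : ContDiff ℝ (⊤ : ℕ∞) (regLog δ) :=
  ((((contDiff_re_fst.pow 2).add (contDiff_im_fst.pow 2)).add contDiff_const).log
    fun z => (regLog_denom_pos hδ z).ne').div_const 2

lemma hasFDerivAt_re_fst (z : C2) :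
    HasFDerivAt (fun z : C2 => z.1.re) (Complex.reCLM.comp (ContinuousLinearMap.fst ℝ ℂ ℂ)) z :=
  (Complex.reCLM.comp (ContinuousLinearMap.fst ℝ ℂ ℂ)).hasFDerivAt

lemma hasFDerivAt_im_fst (z : C2) :
    HasFDerivAt (fun z : C2 => z.1.im) (Complex.imCLM.comp (ContinuousLinearMap.fst ℝ ℂ ℂ)) z :=
  (Complex.imCLM.comp (ContinuousLinearMap.fst ℝ ℂ ℂ)).hasFDerivAt

lemma hasFDerivAt_regLog_denom (z : C2) :
    HasFDerivAt (fun z : C2 => z.1.re ^ 2 + z.1.im ^ 2 + δ)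
      ((2 * z.1.re) • Complex.reCLM.comp (ContinuousLinearMap.fst ℝ ℂ ℂ) +
        (2 * z.1.im) • Complex.imCLM.comp (ContinuousLinearMap.fst ℝ ℂ ℂ)) z := by
  have h := (((hasFDerivAt_re_fst z).pow 2).add ((hasFDerivAt_im_fst z).pow 2)).add_const δ
  simpa using h

lemma fderiv_regLog {z : C2} (hz : z.1.re ^ 2 + z.1.im ^ 2 + δ ≠ 0) (e : C2) :
    fderiv ℝ (regLog δ) z e =
      (z.1.re * e.1.re + z.1.im * e.1.im) * (z.1.re ^ 2 + z.1.im ^ 2 + δ)⁻¹ := by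
  have h := (((hasFDerivAt_regLog_denom (δ := δ) z).log hz).mul_const (2⁻¹ : ℝ)).fderiv
  have h' : regLog δ = fun z : C2 => Real.log (z.1.re ^ 2 + z.1.im ^ 2 + δ) * 2⁻¹ :=
    funext fun z => div_eq_mul_inv _ _
  rw [h', h]
  simp
  ring

lemma fderiv_fderiv_regLog (hδ : 0 < δ) (z e : C2) :
    fderiv ℝ (fun w => fderiv ℝ (regLog δ) w e) z e =
      (e.1.re ^ 2 + e.1.im ^ 2) * (z.1.re ^ 2 + z.1.im ^ 2 + δ)⁻¹ -
      2 * (z.1.re * e.1.re + z.1.im * e.1.im) ^ 2 * ((z.1.re ^ 2 + z.1.im ^ 2 + δ) ^ 2)⁻¹ := by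
  have hne := (regLog_denom_pos hδ z).ne'
  have h1 := ((hasFDerivAt_re_fst z).mul_const e.1.re).add
    ((hasFDerivAt_im_fst z).mul_const e.1.im)
  have h2 := (hasDerivAt_inv hne).comp_hasFDerivAt z (hasFDerivAt_regLog_denom (δ := δ) z)
  have h3 := (h1.mul h2).fderiv
  simp only [fun w => fderiv_regLog (regLog_denom_pos hδ w).ne' e]
  refine (congrArg (fun A : C2 →L[ℝ] ℝ => A e) h3).trans ?_
  simp
  field_simp
  ring

lemma partialLaplacian_zero_regLog (hδ : 0 < δ) (z : C2) :
    partialLaplacian 0 (regLog δ) z = 2 * δ / (‖z.1‖ ^ 2 + δ) ^ 2 := by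
  have hne := (regLog_denom_pos hδ z).ne'
  have hn : ‖z.1‖ ^ 2 = z.1.re ^ 2 + z.1.im ^ 2 := by
    rw [Complex.sq_norm, Complex.normSq_apply]
    ring
  rw [partialLaplacian, fderiv_fderiv_regLog hδ, fderiv_fderiv_regLog hδ, hn]
  simp [basisVec]
  field_simp
  ring

lemma partialLaplacian_one_regLog (hδ : 0 < δ) (z : C2) :
    partialLaplacian 1 (regLog δ) z = 0 := by
  rw [partialLaplacian, fderiv_fderiv_regLog hδ, fderiv_fderiv_regLog hδ]
  simp [basisVec]

lemma abs_regLog_le (hδ : 0 < δ) (hδ1 : δ ≤ 1) {z : C2} (hz : z.1 ≠ 0) :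
    |regLog δ z| ≤ ‖z.1‖⁻¹ + ‖z.1‖ := by
  have hn : z.1.re ^ 2 + z.1.im ^ 2 = ‖z.1‖ ^ 2 := by
    rw [Complex.sq_norm, Complex.normSq_apply]
    ring
  have hp : 0 < ‖z.1‖ := norm_pos_iff.2 hz
  have h3 := inv_pos.2 hp
  rw [regLog, hn, abs_le]
  constructor
  · have h1 := Real.one_sub_inv_le_log_of_pos hp
    have h2 : Real.log (‖z.1‖ ^ 2) ≤ Real.log (‖z.1‖ ^ 2 + δ) :=
      Real.log_le_log (by positivity) (by linarith)
    rw [Real.log_pow] at h2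
    push_cast at h2
    linarith
  · have h1 : Real.log (‖z.1‖ ^ 2 + δ) ≤ Real.log ((1 + ‖z.1‖) ^ 2) :=
      Real.log_le_log (by positivity) (by nlinarith)
    have h2 := Real.log_le_sub_one_of_pos (by positivity : 0 < 1 + ‖z.1‖)
    rw [Real.log_pow] at h1
    push_cast at h1
    linarith

end regLog

/-- Green's formula against a test function. -/
lemma integral_mul_partialLaplacian {g φ : C2 → ℝ} (hg : ContDiff ℝ (⊤ : ℕ∞) g)
    (hφ : ContDiff ℝ (⊤ : ℕ∞) φ) (hc : HasCompactSupport φ) (j : Fin 2) :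
    ∫ z, g z * partialLaplacian j φ z = ∫ z, partialLaplacian j g z * φ z := by
  have hw : ∀ k : C2 → ℝ, ContDiff ℝ (⊤ : ℕ∞) k → HasWeakGrad k (fderiv ℝ k) Set.univ :=
    fun k hk => hasWeakGrad_of_contDiffOn isOpen_univ hk.contDiffOn
  have h1 : ∀ e, ∫ z, g z * fderiv ℝ (fun w => fderiv ℝ φ w e) z e =
      ∫ z, fderiv ℝ (fun w => fderiv ℝ g w e) z e * φ z := by
    intro e
    rw [hw g hg _ (contDiff_fderiv_apply_const hφ e) (hasCompactSupport_fderiv_apply_const hc e)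
      (Set.subset_univ _) e, hw _ (contDiff_fderiv_apply_const hg e) φ hφ hc
      (Set.subset_univ _) e, neg_neg]
  have hl : ∀ k : C2 → ℝ, Continuous k → LocallyIntegrableOn k Set.univ := fun k hk =>
    hk.locallyIntegrable.locallyIntegrableOn _
  simp only [partialLaplacian, mul_add, add_mul]
  rw [integral_add, integral_add, h1, h1]
  · exact integrable_mul_of_tsupport_subset (hl _ (contDiff_fderiv_apply_const
      (contDiff_fderiv_apply_const hg _) _).continuous) hφ.continuous hc (Set.subset_univ _)
  · exact integrable_mul_of_tsupport_subset (hl _ (contDiff_fderiv_apply_const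
      (contDiff_fderiv_apply_const hg _) _).continuous) hφ.continuous hc (Set.subset_univ _)
  · exact integrable_mul_fderiv (hl _ hg.continuous) (contDiff_fderiv_apply_const hφ _)
      (hasCompactSupport_fderiv_apply_const hc _) (Set.subset_univ _) _
  · exact integrable_mul_fderiv (hl _ hg.continuous) (contDiff_fderiv_apply_const hφ _)
      (hasCompactSupport_fderiv_apply_const hc _) (Set.subset_univ _) _

lemma contDiff_partialLaplacian {φ : C2 → ℝ} (hφ : ContDiff ℝ (⊤ : ℕ∞) φ) (j : Fin 2) :
    ContDiff ℝ (⊤ : ℕ∞) (partialLaplacian j φ) :=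
  (contDiff_fderiv_apply_const (contDiff_fderiv_apply_const hφ _) _).add
    (contDiff_fderiv_apply_const (contDiff_fderiv_apply_const hφ _) _)

lemma tsupport_partialLaplacian_subset (φ : C2 → ℝ) (j : Fin 2) :
    tsupport (partialLaplacian j φ) ⊆ tsupport φ := by
  refine (tsupport_add _ _).trans (Set.union_subset ?_ ?_) <;>
  exact (tsupport_fderiv_apply_const_subset _ _).trans (tsupport_fderiv_apply_const_subset _ _)

lemma integrable_mul_partialLaplacian {f φ : C2 → ℝ} {V : Set C2} (hf : LocallyIntegrableOn f V)
    (hφ : ContDiff ℝ (⊤ : ℕ∞) φ) (hc : HasCompactSupport φ) (hV : tsupport φ ⊆ V) (j : Fin 2) :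
    Integrable fun z => f z * partialLaplacian j φ z :=
  integrable_mul_of_tsupport_subset hf (contDiff_partialLaplacian hφ j).continuous
    (hc.of_isClosed_subset (isClosed_tsupport _) (tsupport_partialLaplacian_subset φ j))
    ((tsupport_partialLaplacian_subset φ j).trans hV)

/-- The distributional Laplacian of `log |s|` is the limit of those of its regularizations. -/
lemma tendsto_integral_regLog {φ : C2 → ℝ} (hφ : ContDiff ℝ (⊤ : ℕ∞) φ)
    (hc : HasCompactSupport φ) (j : Fin 2) :
    Tendsto (fun n : ℕ => ∫ z, regLog (((n : ℝ) + 1)⁻¹ ^ 2) z * partialLaplacian j φ z) atTop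
      (𝓝 (∫ z : C2, Real.log ‖z.1‖ * partialLaplacian j φ z)) := by
  have hδ : ∀ n : ℕ, 0 < ((n : ℝ) + 1)⁻¹ ^ 2 := fun n => by positivity
  have hδ1 : ∀ n : ℕ, ((n : ℝ) + 1)⁻¹ ^ 2 ≤ 1 := fun n => by
    refine pow_le_one₀ (by positivity) (inv_le_one_of_one_le₀ ?_)
    have : (0 : ℝ) ≤ n := by positivity
    linarith
  have hne : ∀ᵐ z : C2, z.1 ≠ 0 := by
    have h := (Measure.quasiMeasurePreserving_fst (μ := (volume : Measure ℂ))
      (ν := (volume : Measure ℂ))).ae (p := fun s => s ≠ 0) (by simp [ae_iff])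
    exact h
  refine tendsto_integral_of_dominated_convergence
    (fun z : C2 => ‖(‖z.1‖⁻¹ + ‖z.1‖) * partialLaplacian j φ z‖) (fun n => ?_) ?_ (fun n => ?_) ?_
  · exact ((contDiff_regLog (hδ n)).continuous.mul
      (contDiff_partialLaplacian hφ j).continuous).aestronglyMeasurable
  · exact (integrable_mul_partialLaplacian
      (locallyIntegrable_inv_norm_add_norm_fst.locallyIntegrableOn Set.univ) hφ hc
      (Set.subset_univ _) j).norm
  · filter_upwards [hne] with z hz
    rw [norm_mul, norm_mul, Real.norm_eq_abs, Real.norm_eq_abs (‖z.1‖⁻¹ + ‖z.1‖)]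
    exact mul_le_mul_of_nonneg_right
      ((abs_regLog_le (hδ n) (hδ1 n) hz).trans (le_abs_self _)) (norm_nonneg _)
  · filter_upwards [hne] with z hz
    refine Tendsto.mul_const _ ?_
    have hn : z.1.re ^ 2 + z.1.im ^ 2 = ‖z.1‖ ^ 2 := by
      rw [Complex.sq_norm, Complex.normSq_apply]
      ring
    have hp : 0 < ‖z.1‖ := norm_pos_iff.2 hz
    have h1 : Tendsto (fun n : ℕ => ‖z.1‖ ^ 2 + ((n : ℝ) + 1)⁻¹ ^ 2) atTop (𝓝 (‖z.1‖ ^ 2)) := by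
      simpa using ((tendsto_one_div_add_atTop_nhds_zero_nat (𝕜 := ℝ)).pow 2).const_add (‖z.1‖ ^ 2)
    have h2 := ((Real.continuousAt_log (by positivity : ‖z.1‖ ^ 2 ≠ 0)).tendsto.comp h1).div_const 2
    simp only [regLog, hn]
    convert! h2 using 2
    rw [Real.log_pow]
    push_cast
    ring

/-- `log |s|` does not depend on the second variable. -/
lemma integral_log_mul_partialLaplacian_one {φ : C2 → ℝ} (hφ : ContDiff ℝ (⊤ : ℕ∞) φ)
    (hc : HasCompactSupport φ) : ∫ z : C2, Real.log ‖z.1‖ * partialLaplacian 1 φ z = 0 := by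
  refine tendsto_nhds_unique (tendsto_integral_regLog hφ hc 1) ?_
  have : ∀ n : ℕ, ∫ z, regLog (((n : ℝ) + 1)⁻¹ ^ 2) z * partialLaplacian 1 φ z = 0 := by
    intro n
    have hδ : 0 < ((n : ℝ) + 1)⁻¹ ^ 2 := by positivity
    rw [integral_mul_partialLaplacian (contDiff_regLog hδ) hφ hc]
    simp only [partialLaplacian_one_regLog hδ, zero_mul, integral_zero]
  simp only [this, tendsto_const_nhds]

lemma integral_inv_one_add_norm_sq_sq :
    ∫ w : ℂ, Real.pi⁻¹ * ((‖w‖ ^ 2 + 1) ^ 2)⁻¹ = 1 := by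
  have h := integral_fun_norm_addHaar (volume : Measure ℂ)
    (fun y : ℝ => Real.pi⁻¹ * ((y ^ 2 + 1) ^ 2)⁻¹)
  rw [h]
  have hderiv : ∀ y ∈ Set.Ici (0 : ℝ), HasDerivAt (fun y : ℝ => -((2 * Real.pi)⁻¹ * (y ^ 2 + 1)⁻¹))
      (y ^ (2 - 1) • (Real.pi⁻¹ * ((y ^ 2 + 1) ^ 2)⁻¹)) y := by
    intro y _
    have hy : y ^ 2 + 1 ≠ 0 := by positivity
    have h1 := (((hasDerivAt_pow 2 y).add_const 1).fun_inv hy).const_mul ((2 * Real.pi)⁻¹)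
    convert! h1.neg using 1
    have := Real.pi_ne_zero
    simp
    field_simp
  have hlim : Tendsto (fun y : ℝ => -((2 * Real.pi)⁻¹ * (y ^ 2 + 1)⁻¹)) atTop (𝓝 0) := by
    have h1 : Tendsto (fun y : ℝ => y ^ 2 + 1) atTop atTop :=
      tendsto_atTop_add_const_right _ _ (tendsto_pow_atTop two_ne_zero)
    simpa using (h1.inv_tendsto_atTop.const_mul ((2 * Real.pi)⁻¹)).neg
  have h2 := integral_Ioi_of_hasDerivAt_of_nonneg' hderiv
    (fun y hy => by have : (0 : ℝ) < y := hy; simp; positivity) hlim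
  rw [Complex.finrank_real_complex, h2, Measure.real, Complex.volume_ball]
  simp

/-- The distributional equation `Δ log |s| = 2π [s = 0]`. The Laplacian of `log (|s|² + δ) / 2` is
`2 δ / (|s|² + δ)²`, which for `δ = (n + 1)⁻²` is `2π` times an approximate identity on `ℂ`. -/
lemma integral_log_mul_partialLaplacian_zero {φ : C2 → ℝ} (hφ : ContDiff ℝ (⊤ : ℕ∞) φ)
    (hc : HasCompactSupport φ) :
    ∫ z : C2, Real.log ‖z.1‖ * partialLaplacian 0 φ z = 2 * Real.pi * ∫ t : ℂ, φ (0, t) := by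
  refine tendsto_nhds_unique (tendsto_integral_regLog hφ hc 0) ?_
  let Φ : ℂ → ℝ := fun s => ∫ t, φ (s, t)
  have hint : Integrable φ := hφ.continuous.integrable_of_hasCompactSupport hc
  have hΦint : Integrable Φ := by
    rw [Measure.volume_eq_prod] at hint
    exact hint.integral_prod_left
  have hΦc : Continuous Φ := by
    have hK : IsCompact (Prod.snd '' tsupport φ) := hc.image continuous_snd
    have h1 := continuous_parametric_integral_of_continuous (μ := (volume : Measure ℂ))
      (f := fun s t => φ (s, t)) (by exact hφ.continuous) hK
    convert! h1 using 2 with s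
    refine (setIntegral_eq_integral_of_forall_compl_eq_zero fun t ht => ?_).symm
    exact image_eq_zero_of_notMem_tsupport fun h => ht ⟨_, h, rfl⟩
  have hdecay : Tendsto (fun x : ℂ => ‖x‖ ^ Module.finrank ℝ ℂ *
      (Real.pi⁻¹ * ((‖x‖ ^ 2 + 1) ^ 2)⁻¹)) (Bornology.cobounded ℂ) (𝓝 0) := by
    have h1 : Tendsto (fun x : ℂ => (‖x‖ ^ 2)) (Bornology.cobounded ℂ) atTop :=
      (tendsto_pow_atTop two_ne_zero).comp tendsto_norm_cobounded_atTop
    have h2 := (h1.inv_tendsto_atTop.const_mul Real.pi⁻¹)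
    rw [mul_zero] at h2
    refine squeeze_zero (fun x => by positivity) (fun x => ?_) h2
    rw [Complex.finrank_real_complex]
    simp only [Pi.inv_apply]
    have h3 : ‖x‖ ^ 2 * ((‖x‖ ^ 2 + 1) ^ 2)⁻¹ ≤ (‖x‖ ^ 2)⁻¹ := by
      rcases eq_or_ne x 0 with rfl | hx
      · simp
      · have hp : 0 < ‖x‖ ^ 2 := by positivity
        rw [← div_eq_mul_inv, div_le_iff₀ (by positivity), inv_mul_eq_div, le_div_iff₀ hp]
        nlinarith
    calc ‖x‖ ^ 2 * (Real.pi⁻¹ * ((‖x‖ ^ 2 + 1) ^ 2)⁻¹)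
        = Real.pi⁻¹ * (‖x‖ ^ 2 * ((‖x‖ ^ 2 + 1) ^ 2)⁻¹) := by ring
      _ ≤ Real.pi⁻¹ * (‖x‖ ^ 2)⁻¹ := by gcongr
  have hpeak := tendsto_integral_comp_smul_smul_of_integrable (μ := (volume : Measure ℂ))
    (fun x => by positivity) integral_inv_one_add_norm_sq_sq hdecay hΦint hΦc.continuousAt
  have hN : Tendsto (fun n : ℕ => (n : ℝ) + 1) atTop atTop :=
    tendsto_atTop_add_const_right _ _ tendsto_natCast_atTop_atTop
  have hpeak' := (hpeak.comp hN).const_mul (2 * Real.pi)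
  refine hpeak'.congr fun n => ?_
  have hδ : 0 < ((n : ℝ) + 1)⁻¹ ^ 2 := by positivity
  rw [integral_mul_partialLaplacian (contDiff_regLog hδ) hφ hc]
  simp only [partialLaplacian_zero_regLog hδ, Function.comp_apply]
  have hint2 : Integrable fun z : C2 => 2 * ((n : ℝ) + 1)⁻¹ ^ 2 /
      (‖z.1‖ ^ 2 + ((n : ℝ) + 1)⁻¹ ^ 2) ^ 2 * φ z := by
    refine Continuous.integrable_of_hasCompactSupport ?_ hc.mul_left
    refine Continuous.mul (Continuous.div (by fun_prop) (by fun_prop) fun z => ?_) hφ.continuous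
    positivity
  rw [Measure.volume_eq_prod] at hint2 ⊢
  rw [integral_prod _ hint2, ← integral_const_mul]
  refine integral_congr_ae (Eventually.of_forall fun s => ?_)
  simp only [smul_eq_mul, integral_const_mul, Complex.finrank_real_complex, norm_smul]
  rw [← mul_assoc]
  congr 1
  have h0 : (0 : ℝ) < n + 1 := by positivity
  have := Real.pi_ne_zero
  rw [Real.norm_of_nonneg h0.le]
  field_simp

/-! ### The blow-down map in the charts -/

/-- The blow-down map in the `i`-th chart. -/
def blowDown (i : Fin 2) (q : C2) : C2 := q.1 • direction i q.2

/-- The inverse of the blow-down map in the `i`-th chart, away from the exceptional divisor. -/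
def blowDownInv (i : Fin 2) (z : C2) : C2 := (coord i z, coord (1 - i) z / coord i z)

/-- The complex derivative of the blow-down map in the `i`-th chart. -/
def blowDownDeriv (i : Fin 2) (q : C2) : C2 →L[ℂ] C2 :=
  (ContinuousLinearMap.fst ℂ ℂ ℂ).smulRight (direction i q.2) +
    q.1 • (ContinuousLinearMap.snd ℂ ℂ ℂ).smulRight (basisVec (1 - i))

/-- The adjugate of the derivative of the blow-down map, up to sign: its composition with the
derivative is multiplication by `q.1`. -/
def blowDownAdj (i : Fin 2) (q : C2) : C2 →L[ℂ] C2 :=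
  if i = 0 then
    (q.1 • ContinuousLinearMap.fst ℂ ℂ ℂ).prod
      (ContinuousLinearMap.snd ℂ ℂ ℂ - q.2 • ContinuousLinearMap.fst ℂ ℂ ℂ)
  else
    (q.1 • ContinuousLinearMap.snd ℂ ℂ ℂ).prod
      (ContinuousLinearMap.fst ℂ ℂ ℂ - q.2 • ContinuousLinearMap.snd ℂ ℂ ℂ)

lemma blowDownAdj_apply (i : Fin 2) (q e : C2) :
    blowDownAdj i q e = (q.1 * coord i e, coord (1 - i) e - q.2 * coord i e) := by
  fin_cases i <;> simp [blowDownAdj, coord]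

lemma coord_blowDown (i : Fin 2) (q : C2) : coord i (blowDown i q) = q.1 := by
  fin_cases i <;> simp [blowDown, coord, direction]

lemma blowDownInv_blowDown (i : Fin 2) {q : C2} (hq : q.1 ≠ 0) :
    blowDownInv i (blowDown i q) = q := by
  fin_cases i <;> ext <;> simp [blowDownInv, blowDown, coord, direction, hq]

lemma blowDown_blowDownInv (i : Fin 2) {z : C2} (hz : coord i z ≠ 0) :
    blowDown i (blowDownInv i z) = z := by
  fin_cases i <;> simp [coord] at hz <;> ext <;>
    simp [blowDownInv, blowDown, coord, direction] <;> field_simp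

lemma contDiff_blowDown (i : Fin 2) : ContDiff ℝ (⊤ : ℕ∞) (blowDown i) := by
  unfold blowDown direction
  split_ifs <;> fun_prop

lemma continuous_coord (i : Fin 2) : Continuous (coord i) := by
  unfold coord
  split_ifs <;> fun_prop

lemma contDiff_blowDownAdj_apply (i : Fin 2) (e : C2) :
    ContDiff ℝ (⊤ : ℕ∞) fun q => blowDownAdj i q e := by
  simp only [blowDownAdj_apply]
  fun_prop

lemma continuous_blowDownAdj (i : Fin 2) : Continuous (blowDownAdj i) := by
  fin_cases i
  · refine (ContinuousLinearMap.prodₗᵢ ℂ).continuous.comp (Continuous.prodMk ?_ ?_) <;> fun_prop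
  · refine (ContinuousLinearMap.prodₗᵢ ℂ).continuous.comp (Continuous.prodMk ?_ ?_) <;> fun_prop

lemma continuousOn_blowDownInv (i : Fin 2) : ContinuousOn (blowDownInv i) {z | coord i z ≠ 0} := by
  exact (continuous_coord i).continuousOn.prodMk
    ((continuous_coord _).continuousOn.div (continuous_coord i).continuousOn fun z hz => hz)

lemma hasFDerivAt_blowDown (i : Fin 2) (q : C2) :
    HasFDerivAt (blowDown i) ((blowDownDeriv i q).restrictScalars ℝ) q := by
  have h2 : HasFDerivAt (fun q : C2 => direction i q.2)
      ((ContinuousLinearMap.snd ℂ ℂ ℂ).smulRight (basisVec (1 - i))) q := by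
    have : ∀ q : C2, direction i q.2 =
        ((ContinuousLinearMap.snd ℂ ℂ ℂ).smulRight (basisVec (1 - i))) q + basisVec i := by
      intro q
      fin_cases i <;> simp [direction, basisVec]
    rw [funext this]
    exact (ContinuousLinearMap.hasFDerivAt _).add_const _
  have h := (ContinuousLinearMap.fst ℂ ℂ ℂ).hasFDerivAt (x := q) |>.smul h2
  refine (h.congr_fderiv ?_).restrictScalars ℝ
  rw [blowDownDeriv, add_comm]
  rfl

lemma blowDownDeriv_blowDownAdj (i : Fin 2) (q e : C2) :
    blowDownDeriv i q (blowDownAdj i q e) = q.1 • e := by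
  rw [blowDownAdj_apply]
  fin_cases i <;> ext <;> simp [blowDownDeriv, direction, basisVec, coord] <;> ring

lemma abs_det_blowDownDeriv (i : Fin 2) (q : C2) :
    |((blowDownDeriv i q).restrictScalars ℝ).det| = ‖q.1‖ ^ 2 := by
  have h1 : ((blowDownDeriv i q).restrictScalars ℝ).det =
      Complex.normSq (LinearMap.det (blowDownDeriv i q : C2 →ₗ[ℂ] C2)) := by
    rw [← Algebra.norm_complex_apply, ← LinearMap.det_restrictScalars]
    rfl
  rw [h1, abs_of_nonneg (Complex.normSq_nonneg _), Complex.normSq_eq_norm_sq,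
    ← LinearMap.det_toMatrix (Module.Basis.finTwoProd ℂ), Matrix.det_fin_two]
  fin_cases i <;> simp [LinearMap.toMatrix_apply, blowDownDeriv, direction, basisVec]

lemma injOn_blowDown (i : Fin 2) {N : Set C2} (hN : ∀ q ∈ N, q.1 ≠ 0) :
    Set.InjOn (blowDown i) N := fun q hq q' hq' h => by
  rw [← blowDownInv_blowDown i (hN q hq), h, blowDownInv_blowDown i (hN q' hq')]

lemma isOpen_image_blowDown (i : Fin 2) {N : Set C2} (hN : IsOpen N) (hN0 : ∀ q ∈ N, q.1 ≠ 0) :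
    IsOpen (blowDown i '' N) := by
  have hopen : IsOpen {z | coord i z ≠ 0} := isOpen_ne_fun (continuous_coord i) continuous_const
  convert! (continuousOn_blowDownInv i).isOpen_inter_preimage hopen hN using 1
  ext z
  constructor
  · rintro ⟨q, hq, rfl⟩
    refine ⟨?_, ?_⟩
    · simpa [coord_blowDown] using hN0 q hq
    · simpa [blowDownInv_blowDown i (hN0 q hq)] using hq
  · rintro ⟨h1, h2⟩
    exact ⟨_, h2, blowDown_blowDownInv i h1⟩

lemma integral_image_blowDown (i : Fin 2) {N : Set C2} (hN : IsOpen N) (hN0 : ∀ q ∈ N, q.1 ≠ 0)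
    (g : C2 → ℝ) :
    ∫ z in blowDown i '' N, g z = ∫ q in N, ‖q.1‖ ^ 2 * g (blowDown i q) := by
  rw [integral_image_eq_integral_abs_det_fderiv_smul volume hN.measurableSet
    (fun q _ => (hasFDerivAt_blowDown i q).hasFDerivWithinAt) (injOn_blowDown i hN0)]
  simp only [abs_det_blowDownDeriv, smul_eq_mul]

/-- The blow-down map transports square integrability, with weight the square root of the
Jacobian. -/
lemma memLp_image_blowDown {F : Type} [NormedAddCommGroup F] [NormedSpace ℝ F] (i : Fin 2)
    {N : Set C2} (hN : IsOpen N) (hb : Bornology.IsBounded N) (hN0 : ∀ q ∈ N, q.1 ≠ 0) {g : C2 → F}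
    (hg : MemLp (fun q => ‖q.1‖ • g (blowDown i q)) 2 (volume.restrict N)) :
    MemLp g 2 (volume.restrict (blowDown i '' N)) := by
  have hiff : ∀ {F : Type} [NormedAddCommGroup F] [NormedSpace ℝ F] (g : C2 → F),
      IntegrableOn g (blowDown i '' N) ↔
        IntegrableOn (fun q => ‖q.1‖ ^ 2 • g (blowDown i q)) N := by
    intro F _ _ g
    rw [integrableOn_image_iff_integrableOn_abs_det_fderiv_smul volume hN.measurableSet
      (fun q _ => (hasFDerivAt_blowDown i q).hasFDerivWithinAt) (injOn_blowDown i hN0)]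
    simp only [abs_det_blowDownDeriv]
  have hfin : IsFiniteMeasure (volume.restrict N) := ⟨by simpa using hb.measure_lt_top⟩
  have hg1 : IntegrableOn g (blowDown i '' N) := by
    rw [hiff]
    obtain ⟨C, hC⟩ := hb.exists_norm_le
    have h1 : Integrable (fun q => ‖q.1‖ • g (blowDown i q)) (volume.restrict N) :=
      hg.integrable (by norm_num)
    have h2 := h1.bdd_smul (φ := fun q : C2 => ‖q.1‖) C
      (by fun_prop) (by
        filter_upwards [ae_restrict_mem hN.measurableSet] with q hq
        rw [norm_norm]
        exact (norm_fst_le q).trans (hC q hq))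
    refine h2.congr (Eventually.of_forall fun q => ?_)
    simp [pow_two, mul_smul]
  rw [memLp_two_iff_integrable_sq_norm hg1.1]
  refine (hiff _).2 ?_
  refine ((memLp_two_iff_integrable_sq_norm hg.1).1 hg).congr (Eventually.of_forall fun q => ?_)
  simp [norm_smul, mul_pow]

/-- The real coordinates on `ℂ²`. -/
def realCoord : Fin 4 → C2 →L[ℝ] ℝ :=
  ![Complex.reCLM.comp (ContinuousLinearMap.fst ℝ ℂ ℂ),
    Complex.imCLM.comp (ContinuousLinearMap.fst ℝ ℂ ℂ),
    Complex.reCLM.comp (ContinuousLinearMap.snd ℝ ℂ ℂ),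
    Complex.imCLM.comp (ContinuousLinearMap.snd ℝ ℂ ℂ)]

/-- The real basis of `ℂ²` dual to `realCoord`. -/
def realBasisVec : Fin 4 → C2 := ![(1, 0), (Complex.I, 0), (0, 1), (0, Complex.I)]

lemma sum_realCoord_smul_realBasisVec (v : C2) : ∑ k, realCoord k v • realBasisVec k = v := by
  simp only [Fin.sum_univ_four, realCoord, realBasisVec]
  ext <;> simp

/-- The weak gradient can be tested against smooth divergence free vector fields. -/
lemma HasWeakGrad.integral_vectorField {f : C2 → ℝ} {G : C2 → C2 →L[ℝ] ℝ} {V : Set C2}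
    (h : HasWeakGrad f G V) (hf : LocallyIntegrableOn f V) (hG : LocallyIntegrableOn G V)
    {b : C2 → C2} (hb : ContDiff ℝ (⊤ : ℕ∞) b)
    (hdiv : ∀ q, ∑ k, fderiv ℝ (fun q => realCoord k (b q)) q (realBasisVec k) = 0)
    {ψ : C2 → ℝ} (hψ : ContDiff ℝ (⊤ : ℕ∞) ψ) (hc : HasCompactSupport ψ) (hs : tsupport ψ ⊆ V) :
    ∫ q, f q * fderiv ℝ ψ q (b q) = - ∫ q, G q (b q) * ψ q := by
  have hbk : ∀ k, ContDiff ℝ (⊤ : ℕ∞) fun q => realCoord k (b q) := fun k =>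
    (realCoord k).contDiff.comp hb
  have hφ : ∀ k, ContDiff ℝ (⊤ : ℕ∞) fun q => realCoord k (b q) * ψ q := fun k => (hbk k).mul hψ
  have hφc : ∀ k, HasCompactSupport fun q => realCoord k (b q) * ψ q := fun k => hc.mul_left
  have hφs : ∀ k, tsupport (fun q => realCoord k (b q) * ψ q) ⊆ V := fun k =>
    tsupport_mul_subset_right.trans hs
  have h1 : ∀ q, f q * fderiv ℝ ψ q (b q) =
      ∑ k, f q * fderiv ℝ (fun q => realCoord k (b q) * ψ q) q (realBasisVec k) := by
    intro q
    have h2 : ∀ k, fderiv ℝ (fun q => realCoord k (b q) * ψ q) q (realBasisVec k) =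
        realCoord k (b q) * fderiv ℝ ψ q (realBasisVec k) +
        ψ q * fderiv ℝ (fun q => realCoord k (b q)) q (realBasisVec k) := by
      intro k
      rw [fderiv_fun_mul ((hbk k).differentiable (by simp) q) (hψ.differentiable (by simp) q)]
      simp
    rw [← Finset.mul_sum]
    congr 1
    simp only [h2]
    rw [Finset.sum_add_distrib, ← Finset.mul_sum, hdiv, mul_zero, add_zero]
    conv_lhs => rw [← sum_realCoord_smul_realBasisVec (b q)]
    simp
  have h3 : ∀ q, G q (b q) * ψ q = ∑ k, G q (realBasisVec k) * (realCoord k (b q) * ψ q) := by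
    intro q
    conv_lhs => rw [← sum_realCoord_smul_realBasisVec (b q)]
    simp only [map_sum, map_smul, smul_eq_mul, Finset.sum_mul]
    refine Finset.sum_congr rfl fun k _ => ?_
    ring
  simp only [h1, h3]
  rw [integral_finsetSum _ fun k _ => integrable_mul_fderiv hf (hφ k) (hφc k) (hφs k) _,
    integral_finsetSum _ fun k _ => integrable_clm_mul hG (hφ k).continuous (hφc k) (hφs k) _,
    ← Finset.sum_neg_distrib]
  exact Finset.sum_congr rfl fun k _ => h _ (hφ k) (hφc k) (hφs k) _

/-- The pull-back of the constant vector field `e` under the blow-down map, multiplied by the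
Jacobian (the Piola transform). -/
def piolaField (i : Fin 2) (e q : C2) : C2 := (starRingEnd ℂ) q.1 • blowDownAdj i q e

lemma contDiff_piolaField (i : Fin 2) (e : C2) : ContDiff ℝ (⊤ : ℕ∞) (piolaField i e) := by
  have h : ContDiff ℝ (⊤ : ℕ∞) fun q : C2 => (starRingEnd ℂ) q.1 :=
    Complex.conjCLE.contDiff.comp contDiff_fst
  exact h.smul (contDiff_blowDownAdj_apply i e)

lemma blowDownDeriv_piolaField (i : Fin 2) (e q : C2) :
    blowDownDeriv i q (piolaField i e q) = ‖q.1‖ ^ 2 • e := by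
  rw [piolaField, map_smul, blowDownDeriv_blowDownAdj, smul_smul, Complex.conj_mul']
  rw [← Complex.ofReal_pow, Complex.coe_smul]

/-- Piola's identity for the blow-down map, by computation in the real coordinates. -/
lemma divergence_piolaField (i : Fin 2) (e q : C2) :
    ∑ k, fderiv ℝ (fun q => realCoord k (piolaField i e q)) q (realBasisVec k) = 0 := by
  have hx := (realCoord 0).hasFDerivAt (x := q)
  have hy := (realCoord 1).hasFDerivAt (x := q)
  have hu := (realCoord 2).hasFDerivAt (x := q)
  have hv := (realCoord 3).hasFDerivAt (x := q)
  set σ := coord i e with hσ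
  set τ := coord (1 - i) e with hτ
  have e0 : ∀ q : C2, realCoord 0 (piolaField i e q) =
      (realCoord 0 q ^ 2 + realCoord 1 q ^ 2) * σ.re := by
    intro q
    simp [piolaField, blowDownAdj_apply, realCoord, ← hσ, ← hτ]
    ring
  have e1 : ∀ q : C2, realCoord 1 (piolaField i e q) =
      (realCoord 0 q ^ 2 + realCoord 1 q ^ 2) * σ.im := by
    intro q
    simp [piolaField, blowDownAdj_apply, realCoord, ← hσ, ← hτ]
    ring
  have e2 : ∀ q : C2, realCoord 2 (piolaField i e q) =
      realCoord 0 q * (τ.re - (realCoord 2 q * σ.re - realCoord 3 q * σ.im)) +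
      realCoord 1 q * (τ.im - (realCoord 2 q * σ.im + realCoord 3 q * σ.re)) := by
    intro q
    simp [piolaField, blowDownAdj_apply, realCoord, ← hσ, ← hτ]
  have e3 : ∀ q : C2, realCoord 3 (piolaField i e q) =
      realCoord 0 q * (τ.im - (realCoord 2 q * σ.im + realCoord 3 q * σ.re)) -
      realCoord 1 q * (τ.re - (realCoord 2 q * σ.re - realCoord 3 q * σ.im)) := by
    intro q
    simp [piolaField, blowDownAdj_apply, realCoord, ← hσ, ← hτ]
    ring
  have d0 := (((hx.pow 2).add (hy.pow 2)).mul_const σ.re).fderiv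
  have d1 := (((hx.pow 2).add (hy.pow 2)).mul_const σ.im).fderiv
  have d2 := ((hx.mul (((hu.mul_const σ.re).sub (hv.mul_const σ.im)).const_sub τ.re)).add
    (hy.mul (((hu.mul_const σ.im).add (hv.mul_const σ.re)).const_sub τ.im))).fderiv
  have d3 := ((hx.mul (((hu.mul_const σ.im).add (hv.mul_const σ.re)).const_sub τ.im)).sub
    (hy.mul (((hu.mul_const σ.re).sub (hv.mul_const σ.im)).const_sub τ.re))).fderiv
  rw [Fin.sum_univ_four, funext e0, funext e1, funext e2, funext e3]
  have a0 := congrArg (fun A : C2 →L[ℝ] ℝ => A (realBasisVec 0)) d0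
  have a1 := congrArg (fun A : C2 →L[ℝ] ℝ => A (realBasisVec 1)) d1
  have a2 := congrArg (fun A : C2 →L[ℝ] ℝ => A (realBasisVec 2)) d2
  have a3 := congrArg (fun A : C2 →L[ℝ] ℝ => A (realBasisVec 3)) d3
  refine (congrArg₂ (· + ·) (congrArg₂ (· + ·) (congrArg₂ (· + ·) a0 a1) a2) a3).trans ?_
  simp [realCoord, realBasisVec]
  ring

/-! ### Sobolev functions under the blow-down map -/

/-- The inverse of the derivative of the blow-down map. -/
def blowDownDerivInv (i : Fin 2) (q : C2) : C2 →L[ℝ] C2 :=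
  (q.1⁻¹ • blowDownAdj i q).restrictScalars ℝ

lemma continuousOn_blowDownDerivInv (i : Fin 2) :
    ContinuousOn (blowDownDerivInv i) {q | q.1 ≠ 0} := by
  have h1 : ContinuousOn (fun q : C2 => q.1⁻¹ • blowDownAdj i q) {q | q.1 ≠ 0} :=
    (ContinuousOn.inv₀ continuous_fst.continuousOn fun q hq => hq).smul
      (continuous_blowDownAdj i).continuousOn
  exact (ContinuousLinearMap.continuous_restrictScalars ℝ).comp_continuousOn h1

lemma norm_sq_smul_blowDownDerivInv (i : Fin 2) {q : C2} (hq : q.1 ≠ 0) (e : C2) :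
    ‖q.1‖ ^ 2 • blowDownDerivInv i q e = piolaField i e q := by
  have h : (starRingEnd ℂ) q.1 = (‖q.1‖ ^ 2 : ℝ) * q.1⁻¹ := by
    rw [eq_mul_inv_iff_mul_eq₀ hq, Complex.conj_mul']
    push_cast
    rfl
  rw [piolaField, h, mul_smul, Complex.coe_smul]
  rfl

/-- Change of variables in `W^{1,2}` under the blow-down map. The weights are such that a gradient
of size `1 / |s|` in the direction of `s` is allowed. -/
lemma isW12On_image_blowDown (i : Fin 2) {f : C2 → ℝ} {H : C2 → C2 →L[ℝ] ℝ} {N : Set C2}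
    (hN : IsOpen N) (hb : Bornology.IsBounded N) (hN0 : ∀ q ∈ N, q.1 ≠ 0)
    (hf2 : MemLp (fun q => ‖q.1‖ • f (blowDown i q)) 2 (volume.restrict N))
    (hH2 : MemLp (fun q => ‖q.1‖ • (H q).comp (blowDownDerivInv i q)) 2 (volume.restrict N))
    (hf : LocallyIntegrableOn (fun q => f (blowDown i q)) N) (hH : LocallyIntegrableOn H N)
    (hw : HasWeakGrad (fun q => f (blowDown i q)) H N) : IsW12On f (blowDown i '' N) := by
  let G : C2 → C2 →L[ℝ] ℝ := fun z =>
    (H (blowDownInv i z)).comp (blowDownDerivInv i (blowDownInv i z))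
  have hG : ∀ q ∈ N, G (blowDown i q) = (H q).comp (blowDownDerivInv i q) := by
    intro q hq
    simp only [G, blowDownInv_blowDown i (hN0 q hq)]
  have hGm : MemLp (fun q => ‖q.1‖ • G (blowDown i q)) 2 (volume.restrict N) := by
    refine hH2.ae_eq ?_
    filter_upwards [ae_restrict_mem hN.measurableSet] with q hq
    rw [hG q hq]
  refine ⟨G, memLp_image_blowDown i hN hb hN0 hf2, memLp_image_blowDown i hN hb hN0 hGm,
    fun φ hφ hc hs e => ?_⟩
  let ψ : C2 → ℝ := fun q => φ (blowDown i q)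
  have hψ : ContDiff ℝ (⊤ : ℕ∞) ψ := hφ.comp (contDiff_blowDown i)
  have hcoord : ∀ z ∈ blowDown i '' N, coord i z ≠ 0 := by
    rintro _ ⟨q, hq, rfl⟩
    rw [coord_blowDown]
    exact hN0 q hq
  have hKc : IsCompact (blowDownInv i '' tsupport φ) :=
    hc.image_of_continuousOn ((continuousOn_blowDownInv i).mono fun z hz => hcoord z (hs hz))
  have hψK : tsupport ψ ⊆ blowDownInv i '' tsupport φ := by
    refine closure_minimal (fun q hq => ?_) hKc.isClosed
    have h1 : blowDown i q ∈ tsupport φ := subset_tsupport φ hq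
    have h2 := hcoord _ (hs h1)
    rw [coord_blowDown] at h2
    exact ⟨_, h1, blowDownInv_blowDown i h2⟩
  have hKN : blowDownInv i '' tsupport φ ⊆ N := by
    rintro _ ⟨z, hz, rfl⟩
    obtain ⟨q, hq, rfl⟩ := hs hz
    rwa [blowDownInv_blowDown i (hN0 q hq)]
  have hψs := hψK.trans hKN
  have hψc : HasCompactSupport ψ := hKc.of_isClosed_subset (isClosed_tsupport _) hψK
  have hψd : ∀ q, fderiv ℝ ψ q (piolaField i e q) =
      ‖q.1‖ ^ 2 * fderiv ℝ φ (blowDown i q) e := by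
    intro q
    have h1 := ((hφ.differentiable (by simp) (blowDown i q)).hasFDerivAt.comp q
      (hasFDerivAt_blowDown i q)).fderiv
    change fderiv ℝ (φ ∘ blowDown i) q _ = _
    rw [h1, ContinuousLinearMap.comp_apply, ContinuousLinearMap.coe_restrictScalars',
      blowDownDeriv_piolaField, map_smul, smul_eq_mul]
  have key := hw.integral_vectorField hf hH (contDiff_piolaField i e)
    (divergence_piolaField i e) hψ hψc hψs
  have h1 : ∫ z, f z * fderiv ℝ φ z e =
      ∫ q, f (blowDown i q) * fderiv ℝ ψ q (piolaField i e q) := by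
    have hr : ∫ q in N, f (blowDown i q) * fderiv ℝ ψ q (piolaField i e q) =
        ∫ q, f (blowDown i q) * fderiv ℝ ψ q (piolaField i e q) := by
      refine setIntegral_eq_integral_of_forall_compl_eq_zero fun q hq => ?_
      have h2 : fderiv ℝ ψ q (piolaField i e q) = 0 :=
        image_eq_zero_of_notMem_tsupport (f := fun w => fderiv ℝ ψ w (piolaField i e q))
          fun h => hq (hψs (tsupport_fderiv_apply_const_subset ψ _ h))
      rw [h2, mul_zero]
    have hl : ∫ z in blowDown i '' N, f z * fderiv ℝ φ z e = ∫ z, f z * fderiv ℝ φ z e := by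
      refine setIntegral_eq_integral_of_forall_compl_eq_zero fun z hz => ?_
      have h2 : fderiv ℝ φ z e = 0 :=
        image_eq_zero_of_notMem_tsupport (f := fun w => fderiv ℝ φ w e)
          fun h => hz (hs (tsupport_fderiv_apply_const_subset φ _ h))
      rw [h2, mul_zero]
    rw [← hr, ← hl, integral_image_blowDown i hN hN0]
    refine integral_congr_ae (Eventually.of_forall fun q => ?_)
    simp only [hψd]
    ring
  have h2 : ∫ z, G z e * φ z = ∫ q, H q (piolaField i e q) * ψ q := by
    have hr : ∫ q in N, H q (piolaField i e q) * ψ q = ∫ q, H q (piolaField i e q) * ψ q := by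
      refine setIntegral_eq_integral_of_forall_compl_eq_zero fun q hq => ?_
      rw [image_eq_zero_of_notMem_tsupport fun h => hq (hψs h), mul_zero]
    have hl : ∫ z in blowDown i '' N, G z e * φ z = ∫ z, G z e * φ z := by
      refine setIntegral_eq_integral_of_forall_compl_eq_zero fun z hz => ?_
      rw [image_eq_zero_of_notMem_tsupport fun h => hz (hs h), mul_zero]
    rw [← hr, ← hl, integral_image_blowDown i hN hN0]
    refine setIntegral_congr_fun hN.measurableSet fun q hq => ?_
    simp only [hG q hq, ContinuousLinearMap.comp_apply,
      ← norm_sq_smul_blowDownDerivInv i (hN0 q hq) e, map_smul, smul_eq_mul, ψ]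
    ring
  rw [h1, h2, key]

lemma log_norm_fst_eq_regLog (q : C2) : Real.log ‖q.1‖ = regLog 0 q := by
  have hn : q.1.re ^ 2 + q.1.im ^ 2 = ‖q.1‖ ^ 2 := by
    rw [Complex.sq_norm, Complex.normSq_apply]
    ring
  rw [regLog, add_zero, hn, Real.log_pow]
  push_cast
  ring

lemma regLog_denom_ne_zero {q : C2} (hq : q.1 ≠ 0) : q.1.re ^ 2 + q.1.im ^ 2 + 0 ≠ 0 := by
  have hn : q.1.re ^ 2 + q.1.im ^ 2 + 0 = ‖q.1‖ ^ 2 := by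
    rw [Complex.sq_norm, Complex.normSq_apply]
    ring
  rw [hn]
  exact pow_ne_zero _ (norm_ne_zero_iff.2 hq)

lemma contDiffOn_regLog_zero : ContDiffOn ℝ (⊤ : ℕ∞) (regLog 0) {q | q.1 ≠ 0} :=
  ((((contDiff_re_fst.pow 2).add (contDiff_im_fst.pow 2)).add contDiff_const).contDiffOn.log
    fun _ hq => regLog_denom_ne_zero hq).div_const 2

/-- The gradient of `log |s|` transported to `ℂ²` has size `1 / |s|`. -/
lemma norm_smul_fderiv_regLog_comp_le (i : Fin 2) {q : C2} (hq : q.1 ≠ 0) :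
    ‖‖q.1‖ • (fderiv ℝ (regLog 0) q).comp (blowDownDerivInv i q)‖ ≤ 1 := by
  refine ContinuousLinearMap.opNorm_le_bound _ zero_le_one fun e => ?_
  have hp : 0 < ‖q.1‖ := norm_pos_iff.2 hq
  have hn : q.1.re ^ 2 + q.1.im ^ 2 + 0 = ‖q.1‖ ^ 2 := by
    rw [Complex.sq_norm, Complex.normSq_apply]
    ring
  have h1 : (blowDownDerivInv i q e).1 = coord i e := by
    change q.1⁻¹ • (blowDownAdj i q e).1 = _
    rw [blowDownAdj_apply, smul_eq_mul, inv_mul_cancel_left₀ hq]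
  have h2 : ‖coord i e‖ ≤ ‖e‖ := by
    fin_cases i
    · exact norm_fst_le e
    · exact norm_snd_le e
  have h3 : |q.1.re * (coord i e).re + q.1.im * (coord i e).im| ≤ ‖q.1‖ * ‖coord i e‖ := by
    have h4 : q.1.re * (coord i e).re + q.1.im * (coord i e).im =
        ((starRingEnd ℂ) q.1 * coord i e).re := by simp
    rw [h4, ← Complex.norm_conj q.1, ← norm_mul]
    exact Complex.abs_re_le_norm _
  rw [_root_.smul_apply, ContinuousLinearMap.comp_apply,
    fderiv_regLog (regLog_denom_ne_zero hq), h1, hn, smul_eq_mul, norm_mul, norm_mul, norm_norm,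
    norm_inv, norm_pow, norm_norm, Real.norm_eq_abs,
    one_mul]
  calc ‖q.1‖ * (|q.1.re * (coord i e).re + q.1.im * (coord i e).im| * (‖q.1‖ ^ 2)⁻¹)
      ≤ ‖q.1‖ * ((‖q.1‖ * ‖coord i e‖) * (‖q.1‖ ^ 2)⁻¹) := by gcongr
    _ = ‖coord i e‖ := by field_simp
    _ ≤ ‖e‖ := h2

/-- If `f ∘ π` is, near a point of a chart of the blow-up, the sum of a function in `W^{1,2}` and a
multiple of `log |s|`, then `f` is in `W^{1,2}` on the image of a neighbourhood of that point. -/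
lemma exists_isW12On_image_blowDown (i : Fin 2) {f v : C2 → ℝ} {N₀ : Set C2} (hN₀ : IsOpen N₀)
    {q₀ : C2} (hq₀ : q₀ ∈ N₀) (hv : IsW12On v N₀) (ν : ℝ)
    (hfe : (fun q => f (blowDown i q)) =ᵐ[volume.restrict N₀]
      fun q => v q + ν * Real.log ‖q.1‖) :
    ∃ N : Set C2, IsOpen N ∧ q₀ ∈ N ∧ IsW12On f (blowDown i '' (N ∩ {q | q.1 ≠ 0})) := by
  refine ⟨N₀ ∩ Metric.ball q₀ 1, hN₀.inter Metric.isOpen_ball,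
    ⟨hq₀, Metric.mem_ball_self one_pos⟩, ?_⟩
  set N := N₀ ∩ Metric.ball q₀ 1 ∩ {q : C2 | q.1 ≠ 0} with hNdef
  have hopen : IsOpen {q : C2 | q.1 ≠ 0} := isOpen_ne_fun continuous_fst continuous_const
  have hN : IsOpen N := (hN₀.inter Metric.isOpen_ball).inter hopen
  have hNN₀ : N ⊆ N₀ := fun q hq => hq.1.1
  have hNb : N ⊆ Metric.closedBall q₀ 1 := fun q hq => Metric.ball_subset_closedBall hq.1.2
  have hN0 : ∀ q ∈ N, q.1 ≠ 0 := fun q hq => hq.2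
  have hb : Bornology.IsBounded N := Metric.isBounded_closedBall.subset hNb
  have hfin : IsFiniteMeasure (volume.restrict N) := ⟨by simpa using hb.measure_lt_top⟩
  have hmem := ae_restrict_mem (μ := volume) hN.measurableSet
  obtain ⟨Gv, hGv⟩ := hv
  have hGv := hGv.mono hNN₀
  obtain ⟨C₁, hC₁⟩ := hb.exists_norm_le
  obtain ⟨C₂, hC₂⟩ := (isCompact_closedBall q₀ 1).exists_bound_of_continuousOn
    (continuous_blowDownAdj i).continuousOn
  have hfe' : (fun q => v q + ν * regLog 0 q) =ᵐ[volume.restrict N]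
      fun q => f (blowDown i q) := by
    have := (hfe.filter_mono (ae_mono (Measure.restrict_mono hNN₀ le_rfl))).symm
    simpa only [log_norm_fst_eq_regLog] using this
  have hR : ContDiffOn ℝ (⊤ : ℕ∞) (regLog 0) N := contDiffOn_regLog_zero.mono fun q hq => hq.2
  have hRc' : ContinuousOn (fderiv ℝ (regLog 0)) N := hR.continuousOn_fderiv_of_isOpen hN (by simp)
  have hRl : LocallyIntegrableOn (fun q => ν * regLog 0 q) N :=
    (continuousOn_const.mul hR.continuousOn).locallyIntegrableOn hN.measurableSet
  have hRl' : LocallyIntegrableOn (fun q => ν • fderiv ℝ (regLog 0) q) N :=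
    (hRc'.const_smul ν).locallyIntegrableOn hN.measurableSet
  have hvl := locallyIntegrableOn_of_memLp hGv.memLp
  have hvl' := locallyIntegrableOn_of_memLp hGv.memLp_grad
  have hw : HasWeakGrad (fun q => v q + ν * regLog 0 q)
      (fun q => Gv q + ν • fderiv ℝ (regLog 0) q) N :=
    hGv.weakGrad.add hvl hvl' hRl hRl' ((hasWeakGrad_of_contDiffOn hN hR).const_mul ν)
  have hAm : AEStronglyMeasurable (blowDownDerivInv i) (volume.restrict N) :=
    ((continuousOn_blowDownDerivInv i).mono fun q hq => hq.2).aestronglyMeasurable hN.measurableSet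
  have hcomp : ∀ K : C2 → C2 →L[ℝ] ℝ, AEStronglyMeasurable K (volume.restrict N) →
      AEStronglyMeasurable (fun q => ‖q.1‖ • (K q).comp (blowDownDerivInv i q))
        (volume.restrict N) := fun K hK =>
    AEStronglyMeasurable.smul (f := fun q : C2 => ‖q.1‖) (by fun_prop)
      ((ContinuousLinearMap.compL ℝ C2 C2 ℝ).aestronglyMeasurable_comp₂ hK hAm)
  refine isW12On_image_blowDown i (H := fun q => Gv q + ν • fderiv ℝ (regLog 0) q) hN hb hN0
    ?_ ?_ ?_ (hvl'.add hRl') (hw.congr_ae hN.measurableSet hfe' ae_eq_rfl)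
  · have h1 : MemLp (fun q => ‖q.1‖ * v q) 2 (volume.restrict N) := by
      refine hGv.memLp.of_le_mul (c := C₁) (AEStronglyMeasurable.mul (by fun_prop) hGv.memLp.1) ?_
      filter_upwards [hmem] with q hq
      rw [norm_mul, norm_norm]
      gcongr
      exact (norm_fst_le q).trans (hC₁ q hq)
    have h2 : MemLp (fun q => ‖q.1‖ * (ν * regLog 0 q)) 2 (volume.restrict N) := by
      refine MemLp.of_bound (AEStronglyMeasurable.mul (by fun_prop)
        ((continuousOn_const.mul hR.continuousOn).aestronglyMeasurable hN.measurableSet))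
        (|ν| * (1 + C₁ ^ 2)) ?_
      filter_upwards [hmem] with q hq
      have hp : 0 < ‖q.1‖ := norm_pos_iff.2 (hN0 q hq)
      have h3 : ‖q.1‖ ≤ C₁ := (norm_fst_le q).trans (hC₁ q hq)
      rw [← log_norm_fst_eq_regLog, norm_mul, norm_mul, norm_norm, Real.norm_eq_abs,
        Real.norm_eq_abs]
      calc ‖q.1‖ * (|ν| * |Real.log ‖q.1‖|)
          ≤ ‖q.1‖ * (|ν| * (‖q.1‖⁻¹ + ‖q.1‖)) := by
            gcongr
            exact abs_log_norm_le q.1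
        _ = |ν| * (1 + ‖q.1‖ ^ 2) := by field_simp
        _ ≤ |ν| * (1 + C₁ ^ 2) := by gcongr
    refine (memLp_fun_add h1 h2).ae_eq ?_
    filter_upwards [hfe'] with q hq
    rw [← hq, smul_eq_mul]
    ring
  · have h1 : MemLp (fun q => ‖q.1‖ • (Gv q).comp (blowDownDerivInv i q)) 2
        (volume.restrict N) := by
      refine hGv.memLp_grad.of_le_mul (c := C₂) (hcomp _ hGv.memLp_grad.1) ?_
      filter_upwards [hmem] with q hq
      have hp : 0 < ‖q.1‖ := norm_pos_iff.2 (hN0 q hq)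
      have h2 : ‖blowDownDerivInv i q‖ = ‖q.1‖⁻¹ * ‖blowDownAdj i q‖ := by
        rw [blowDownDerivInv, ContinuousLinearMap.norm_restrictScalars, norm_smul, norm_inv]
      calc ‖‖q.1‖ • (Gv q).comp (blowDownDerivInv i q)‖
          ≤ ‖q.1‖ * (‖Gv q‖ * ‖blowDownDerivInv i q‖) := by
            rw [norm_smul, norm_norm]
            gcongr
            exact ContinuousLinearMap.opNorm_comp_le _ _
        _ = ‖blowDownAdj i q‖ * ‖Gv q‖ := by
            rw [h2]
            field_simp
        _ ≤ C₂ * ‖Gv q‖ := by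
            gcongr
            exact hC₂ q (hNb hq)
    have h2 : MemLp (fun q => ν • ‖q.1‖ • (fderiv ℝ (regLog 0) q).comp (blowDownDerivInv i q)) 2
        (volume.restrict N) := by
      refine MemLp.of_bound ((hcomp _ (hRc'.aestronglyMeasurable hN.measurableSet)).const_smul ν)
        |ν| ?_
      filter_upwards [hmem] with q hq
      rw [norm_smul, Real.norm_eq_abs]
      exact mul_le_of_le_one_right (abs_nonneg _) (norm_smul_fderiv_regLog_comp_le i (hN0 q hq))
    refine (memLp_fun_add h1 h2).ae_eq (Eventually.of_forall fun q => ?_)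
    simp only [ContinuousLinearMap.add_comp, ContinuousLinearMap.smul_comp, smul_add]
    rw [smul_comm]
  · have h1 : LocallyIntegrableOn (fun q => v q + ν * regLog 0 q) N := hvl.add hRl
    intro q hq
    obtain ⟨U, hU, hi⟩ := h1 q hq
    refine ⟨U ∩ N, inter_mem hU self_mem_nhdsWithin, ?_⟩
    exact (hi.mono_set Set.inter_subset_left).congr
      (hfe'.filter_mono (ae_mono (Measure.restrict_mono Set.inter_subset_right le_rfl)))

/-! ### Potentials and partial Laplacians -/

/-- The form whose only coefficient is `φ`, in position `(m, m)`. -/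
def diagForm (m : Fin 2) (φ : C2 → ℝ) (z : C2) (j k : Fin 2) : ℂ :=
  if j = m ∧ k = m then (φ z : ℂ) else 0

lemma tsupport_diagForm_subset (m : Fin 2) (φ : C2 → ℝ) :
    tsupport (diagForm m φ) ⊆ tsupport φ := by
  refine closure_mono fun z hz h => hz ?_
  ext j k
  simp [diagForm, h]

/-- The form `diagForm m φ` as a test form. -/
def diagTestForm {Ω : TopologicalSpace.Opens C2} (m : Fin 2) (φ : C2 → ℝ)
    (hφ : ContDiff ℝ (⊤ : ℕ∞) φ) (hc : HasCompactSupport φ) (hs : tsupport φ ⊆ Ω) :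
    TestForm Ω where
  toFun := diagForm m φ
  contDiff' := by
    rw [contDiff_pi]
    intro j
    rw [contDiff_pi]
    intro k
    by_cases h : j = m ∧ k = m
    · simp only [diagForm, h, and_self, if_true]
      exact Complex.ofRealCLM.contDiff.comp hφ
    · simp only [diagForm, h, if_false]
      exact contDiff_const
  hasCompactSupport' := hc.of_isClosed_subset (isClosed_tsupport _) (tsupport_diagForm_subset m φ)
  tsupport_subset' := (tsupport_diagForm_subset m φ).trans hs

lemma coe_diagTestForm {Ω : TopologicalSpace.Opens C2} (m : Fin 2) (φ : C2 → ℝ)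
    (hφ : ContDiff ℝ (⊤ : ℕ∞) φ) (hc : HasCompactSupport φ) (hs : tsupport φ ⊆ Ω) :
    ⇑(diagTestForm m φ hφ hc hs) = diagForm m φ := rfl

lemma fderiv_ofReal_comp {φ : C2 → ℝ} (hφ : ContDiff ℝ (⊤ : ℕ∞) φ) (z e : C2) :
    fderiv ℝ (fun w => (φ w : ℂ)) z e = (fderiv ℝ φ z e : ℂ) := by
  have h := (Complex.ofRealCLM.hasFDerivAt.comp z
    (hφ.differentiable (by simp) z).hasFDerivAt).fderiv
  exact congrArg (fun A : C2 →L[ℝ] ℂ => A e) h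

lemma fderiv_fderiv_comm {φ : C2 → ℝ} (hφ : ContDiff ℝ (⊤ : ℕ∞) φ) (z a b : C2) :
    fderiv ℝ (fun w => fderiv ℝ φ w a) z b = fderiv ℝ (fun w => fderiv ℝ φ w b) z a := by
  have h1 : DifferentiableAt ℝ (fderiv ℝ φ) z :=
    (hφ.fderiv_right (m := (⊤ : ℕ∞)) (by simp)).differentiable (by simp) z
  have h2 : ∀ a b, fderiv ℝ (fun w => fderiv ℝ φ w a) z b = fderiv ℝ (fderiv ℝ φ) z b a := by
    intro a b
    rw [fderiv_clm_apply h1 (differentiableAt_const a)]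
    simp
  rw [h2, h2]
  exact (hφ.contDiffAt.isSymmSndFDerivAt (by simp; norm_cast)).eq b a

/-- On real functions, `∂/∂z_j ∂/∂z̄_j` is a quarter of the partial Laplacian. -/
lemma dz_dzbar_ofReal {φ : C2 → ℝ} (hφ : ContDiff ℝ (⊤ : ℕ∞) φ) (j : Fin 2) (z : C2) :
    dz j (dzbar j fun w => (φ w : ℂ)) z = ((partialLaplacian j φ z / 4 : ℝ) : ℂ) := by
  have h1 : (dzbar j fun w => (φ w : ℂ)) = fun w =>
      ((fderiv ℝ φ w (basisVec j) : ℝ) : ℂ) * (1 / 2) +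
        ((fderiv ℝ φ w (Complex.I • basisVec j) : ℝ) : ℂ) * (Complex.I / 2) := by
    funext w
    rw [dzbar, fderiv_ofReal_comp hφ, fderiv_ofReal_comp hφ]
    ring
  have hd : ∀ a, Differentiable ℝ fun w => ((fderiv ℝ φ w a : ℝ) : ℂ) := fun a =>
    Complex.ofRealCLM.differentiable.comp
      ((contDiff_fderiv_apply_const hφ a).differentiable (by simp))
  have h2 : ∀ e, fderiv ℝ (dzbar j fun w => (φ w : ℂ)) z e =
      ((fderiv ℝ (fun w => fderiv ℝ φ w (basisVec j)) z e : ℝ) : ℂ) * (1 / 2) +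
      ((fderiv ℝ (fun w => fderiv ℝ φ w (Complex.I • basisVec j)) z e : ℝ) : ℂ) *
        (Complex.I / 2) := by
    intro e
    rw [h1, fderiv_fun_add ((hd _ z).mul_const _) ((hd _ z).mul_const _),
      fderiv_mul_const (hd _ z), fderiv_mul_const (hd _ z), _root_.add_apply,
      _root_.smul_apply, _root_.smul_apply,
      fderiv_ofReal_comp (contDiff_fderiv_apply_const hφ _),
      fderiv_ofReal_comp (contDiff_fderiv_apply_const hφ _), smul_eq_mul, smul_eq_mul]
    ring
  rw [dz, h2, h2, fderiv_fderiv_comm hφ z (basisVec j) (Complex.I • basisVec j), partialLaplacian]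
  push_cast
  ring_nf
  rw [Complex.I_sq]
  ring

/-- Testing a potential with a form whose only coefficient is in position `(1 - j, 1 - j)` gives its
`j`-th partial Laplacian. -/
lemma ddc_diagForm {φ : C2 → ℝ} (hφ : ContDiff ℝ (⊤ : ℕ∞) φ) (j : Fin 2) (z : C2) :
    ddc (diagForm (1 - j) φ) z = ((Real.pi⁻¹ * partialLaplacian j φ z : ℝ) : ℂ) := by
  have h0 : ∀ k l (w : C2), dz k (dzbar l fun _ => (0 : ℂ)) w = 0 := by
    intro k l w
    have h : (dzbar l fun _ => (0 : ℂ)) = fun _ => 0 := by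
      funext w
      simp [dzbar]
    rw [h]
    simp [dz]
  fin_cases j
  · simp [ddc, diagForm, h0, dz_dzbar_ofReal hφ]
    ring
  · simp [ddc, diagForm, h0, dz_dzbar_ofReal hφ]
    ring

lemma IsPshPotential.apply_diagTestForm {Ω : TopologicalSpace.Opens C2} {T : Current Ω}
    {V : Set C2} {u : C2 → EReal} (h : IsPshPotential T V u) (j : Fin 2) {φ : C2 → ℝ}
    (hφ : ContDiff ℝ (⊤ : ℕ∞) φ) (hc : HasCompactSupport φ) (hs : tsupport φ ⊆ Ω)
    (hsV : tsupport φ ⊆ V) :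
    T (diagTestForm (1 - j) φ hφ hc hs) =
      ((Real.pi⁻¹ * ∫ z, (u z).toReal * partialLaplacian j φ z : ℝ) : ℂ) := by
  have key := h.2.2 (diagTestForm (1 - j) φ hφ hc hs)
    (by rw [coe_diagTestForm]; exact (tsupport_diagForm_subset _ _).trans hsV)
  rw [key, ← integral_const_mul, ← integral_complex_ofReal]
  refine integral_congr_ae (Eventually.of_forall fun z => ?_)
  simp only [coe_diagTestForm, ddc_diagForm hφ]
  push_cast
  ring

/-- Two potentials of the same current differ by a smooth function. -/
lemma IsPshPotential.exists_ae_eq_add {Ω : TopologicalSpace.Opens C2} {T : Current Ω}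
    {V V' : Set C2} {u u' : C2 → EReal} (hV : IsOpen V) (hV' : IsOpen V') (hVΩ : V ⊆ Ω)
    (h : IsPshPotential T V u) (h' : IsPshPotential T V' u') {p : C2} (hp : p ∈ V) (hp' : p ∈ V') :
    ∃ W : Set C2, IsOpen W ∧ p ∈ W ∧ ∃ g : C2 → ℝ, ContDiff ℝ (⊤ : ℕ∞) g ∧
      (fun z => (u z).toReal) =ᵐ[volume.restrict W] fun z => (u' z).toReal + g z := by
  have hl : LocallyIntegrableOn (fun z => (u z).toReal) (V ∩ V') :=
    h.2.1.mono_set Set.inter_subset_left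
  have hl' : LocallyIntegrableOn (fun z => (u' z).toReal) (V ∩ V') :=
    h'.2.1.mono_set Set.inter_subset_right
  obtain ⟨W, hW, hpW, g, hg, hgW⟩ :=
    exists_contDiff_ae_eq_of_integral_partialLaplacian_eq_zero
      (h := fun z => (u z).toReal - (u' z).toReal) (hV.inter hV') (hl.sub hl')
      (fun j φ hφ hc hs => by
        have e1 := h.apply_diagTestForm j hφ hc ((hs.trans Set.inter_subset_left).trans hVΩ)
          (hs.trans Set.inter_subset_left)
        have e2 := h'.apply_diagTestForm j hφ hc ((hs.trans Set.inter_subset_left).trans hVΩ)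
          (hs.trans Set.inter_subset_right)
        have e3 := mul_left_cancel₀ (inv_ne_zero Real.pi_ne_zero)
          (Complex.ofReal_injective (e1.symm.trans e2))
        simp only [sub_mul]
        rw [integral_sub (integrable_mul_partialLaplacian hl hφ hc hs j)
          (integrable_mul_partialLaplacian hl' hφ hc hs j), e3, sub_self])
      (p := p) ⟨hp, hp'⟩
  refine ⟨W, hW, hpW, g, hg, ?_⟩
  filter_upwards [hgW] with z hz
  rw [← hz]
  ring

/-! ### Descent from the blow-up -/

section descent

variable {B : TopologicalSpace.Opens C2} {i : Fin 2} {S R : Current (chartDomain B i)} {ν : ℝ}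
  {V : Set C2} {u : C2 → EReal}

/-- `[E] = dd^c log |s|` in the charts, by `Δ log |s| = 2π [s = 0]`. -/
lemma integrationE_diagTestForm (j : Fin 2) {φ : C2 → ℝ}
    (hφ : ContDiff ℝ (⊤ : ℕ∞) φ) (hc : HasCompactSupport φ) (hs : tsupport φ ⊆ chartDomain B i) :
    integrationE B i (diagTestForm (1 - j) φ hφ hc hs) =
      ((Real.pi⁻¹ * ∫ z : C2, Real.log ‖z.1‖ * partialLaplacian j φ z : ℝ) : ℂ) := by
  have hπ := Real.pi_ne_zero
  fin_cases j
  · simp only [Fin.zero_eta, integral_log_mul_partialLaplacian_zero hφ hc]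
    simp only [integrationE, coe_diagTestForm, diagForm, sub_zero, and_self, if_true]
    rw [integral_const_mul, integral_complex_ofReal, ← Complex.ofReal_ofNat, ← Complex.ofReal_mul]
    congr 1
    field_simp
  · simp only [Fin.mk_one, integral_log_mul_partialLaplacian_one hφ hc]
    simp [integrationE, coe_diagTestForm, diagForm]

/-- If `π^*T - ν [E]` has a potential `v` in `W^{1,2}` near a point of a chart, then `u ∘ π` differs
from `v + ν log |s|` by a smooth function there. -/
lemma exists_isW12On_image_of_potential
    (hR : ∀ α, R α = S α - (ν : ℂ) * integrationE B i α) (hW : HasPshPotentialsW12Loc R)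
    (hV : IsOpen V)
    (hS : IsPshPotential S {q | (chart i q).1 ∈ V} fun q => u (chart i q).1)
    {q₀ : C2} (hq₀ : q₀ ∈ chartDomain B i) (hq₀V : blowDown i q₀ ∈ V) :
    ∃ N : Set C2, IsOpen N ∧ q₀ ∈ N ∧
      IsW12On (fun z => (u z).toReal) (blowDown i '' (N ∩ {q | q.1 ≠ 0})) := by
  obtain ⟨N₀, hN₀, hq₀N, hN₀B, v, hv, hvW⟩ := hW q₀ hq₀
  have hV' : IsOpen {q | (chart i q).1 ∈ V} := hV.preimage (contDiff_blowDown i).continuous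
  set D := N₀ ∩ {q | (chart i q).1 ∈ V} with hD
  have hDo : IsOpen D := hN₀.inter hV'
  have l1 : LocallyIntegrableOn (fun q => (u (blowDown i q)).toReal) D :=
    hS.2.1.mono_set Set.inter_subset_right
  have l2 : LocallyIntegrableOn (fun q => (v q).toReal) D := hv.2.1.mono_set Set.inter_subset_left
  have l3 : LocallyIntegrableOn (fun q : C2 => ν * Real.log ‖q.1‖) D :=
    (locallyIntegrable_log_norm_fst.smul ν).locallyIntegrableOn D
  obtain ⟨W, hWo, hqW, g, hg, hgW⟩ :=
    exists_contDiff_ae_eq_of_integral_partialLaplacian_eq_zero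
      (h := fun q => (u (blowDown i q)).toReal - (v q).toReal - ν * Real.log ‖q.1‖) hDo
      ((l1.sub l2).sub l3) (fun j φ hφ hc hs => by
        have hsB : tsupport φ ⊆ chartDomain B i := (hs.trans Set.inter_subset_left).trans hN₀B
        have e1 := hv.apply_diagTestForm j hφ hc hsB (hs.trans Set.inter_subset_left)
        have e2 := hS.apply_diagTestForm j hφ hc hsB (hs.trans Set.inter_subset_right)
        rw [hR, e2, integrationE_diagTestForm, ← Complex.ofReal_mul, ← Complex.ofReal_sub] at e1
        have e3 := Complex.ofReal_injective e1
        have e4 : (∫ z, (u (blowDown i z)).toReal * partialLaplacian j φ z) -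
            ν * (∫ z : C2, Real.log ‖z.1‖ * partialLaplacian j φ z) =
            ∫ z, (v z).toReal * partialLaplacian j φ z := by
          refine mul_left_cancel₀ (inv_ne_zero Real.pi_ne_zero) ?_
          rw [← e3]
          change _ = Real.pi⁻¹ * (∫ z, (u (blowDown i z)).toReal * partialLaplacian j φ z) - _
          ring
        have i1 := integrable_mul_partialLaplacian l1 hφ hc hs j
        have i2 := integrable_mul_partialLaplacian l2 hφ hc hs j
        have i3 := integrable_mul_partialLaplacian l3 hφ hc hs j
        simp only [sub_mul]
        have i12 : Integrable fun z => (u (blowDown i z)).toReal * partialLaplacian j φ z -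
            (v z).toReal * partialLaplacian j φ z := i1.sub i2
        rw [integral_sub i12 i3, integral_sub i1 i2, ← e4]
        simp only [mul_assoc, integral_const_mul]
        ring)
      (p := q₀) ⟨hq₀N, hq₀V⟩
  obtain ⟨U, hU, hqU, -, hvU⟩ := hvW.exists_isW12On hN₀ hq₀N
  let M := U ∩ W ∩ Metric.ball q₀ 1
  have hM : IsOpen M := (hU.inter hWo).inter Metric.isOpen_ball
  have hvg : IsW12On (fun q => (v q).toReal + g q) M :=
    (hvU.mono fun q hq => hq.1.1).add (isW12On_of_contDiff hg hM
      (Metric.isBounded_ball.subset Set.inter_subset_right))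
  refine exists_isW12On_image_blowDown i hM ⟨⟨hqU, hqW⟩, Metric.mem_ball_self one_pos⟩ hvg ν ?_
  have hMW : M ⊆ W := fun q hq => hq.1.2
  filter_upwards [hgW.filter_mono (ae_mono (Measure.restrict_mono hMW le_rfl))] with q hq
  rw [← hq]
  ring

end descent

/-- If a function is in `W^{1,2}` on the image of a neighbourhood of every point of the exceptional
divisor, then it is in `W^{1,2}` near the origin. -/
lemma exists_isW12On_zero {f : C2 → ℝ}
    (h : ∀ (i : Fin 2) (t : ℂ), ∃ N : Set C2, IsOpen N ∧ (0, t) ∈ N ∧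
      IsW12On f (blowDown i '' (N ∩ {q | q.1 ≠ 0}))) :
    ∃ U : Set C2, IsOpen U ∧ (0 : C2) ∈ U ∧ IsW12On f U := by
  have hopen : IsOpen {q : C2 | q.1 ≠ 0} := isOpen_ne_fun continuous_fst continuous_const
  have himg : ∀ (i : Fin 2) (N : Set C2), IsOpen N →
      IsOpen (blowDown i '' (N ∩ {q | q.1 ≠ 0})) := fun i N hN =>
    isOpen_image_blowDown i (hN.inter hopen) fun q hq => hq.2
  -- the closed discs `|t| ≤ 1` in the two charts cover the exceptional divisor
  have key : ∀ i : Fin 2, ∃ δ > 0, ∃ N : Set C2, IsOpen N ∧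
      Metric.ball (0 : ℂ) δ ×ˢ Metric.closedBall (0 : ℂ) 1 ⊆ N ∧
      IsW12On f (blowDown i '' (N ∩ {q | q.1 ≠ 0})) := by
    intro i
    have hK : IsCompact (({0} : Set ℂ) ×ˢ Metric.closedBall (0 : ℂ) 1) :=
      isCompact_singleton.prod (isCompact_closedBall _ _)
    obtain ⟨N, hN, hKN, hNW⟩ := hK.induction_on
      (p := fun s => ∃ N : Set C2, IsOpen N ∧ s ⊆ N ∧
        IsW12On f (blowDown i '' (N ∩ {q | q.1 ≠ 0})))
      ⟨∅, isOpen_empty, subset_rfl, by simpa using isW12On_empty f⟩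
      (fun s t hst ⟨N, hN, htN, hW⟩ => ⟨N, hN, hst.trans htN, hW⟩)
      (fun s t ⟨N, hN, hsN, hW⟩ ⟨N', hN', htN', hW'⟩ =>
        ⟨N ∪ N', hN.union hN', Set.union_subset_union hsN htN', by
          rw [Set.union_inter_distrib_right, Set.image_union]
          exact hW.union (himg i N hN) (himg i N' hN') hW'⟩)
      (fun x hx => by
        obtain ⟨x₁, x₂⟩ := x
        obtain rfl : x₁ = 0 := hx.1
        obtain ⟨N, hN, hxN, hW⟩ := h i x₂
        exact ⟨N, mem_nhdsWithin_of_mem_nhds (hN.mem_nhds hxN), N, hN, subset_rfl, hW⟩)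
    obtain ⟨A, A', hA, -, h0A, hA', hAN⟩ := generalized_tube_lemma isCompact_singleton
      (isCompact_closedBall (0 : ℂ) 1) hN hKN
    obtain ⟨δ, hδ, hδA⟩ := Metric.isOpen_iff.1 hA 0 (h0A rfl)
    exact ⟨δ, hδ, N, hN, (Set.prod_mono hδA hA').trans hAN, hNW⟩
  choose δ hδ N hN hNs hNW using key
  refine ⟨Metric.ball 0 (min (δ 0) (δ 1)), Metric.isOpen_ball,
    Metric.mem_ball_self (lt_min (hδ 0) (hδ 1)), isW12On_of_diff_zero ?_⟩
  refine ((hNW 0).union (himg 0 _ (hN 0)) (himg 1 _ (hN 1)) (hNW 1)).mono ?_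
  rintro ⟨z₁, z₂⟩ ⟨hz, hz0⟩
  have hz' : ‖z₁‖ < min (δ 0) (δ 1) ∧ ‖z₂‖ < min (δ 0) (δ 1) := by
    have := mem_ball_zero_iff.1 hz
    rw [Prod.norm_def] at this
    exact ⟨(le_max_left _ _).trans_lt this, (le_max_right _ _).trans_lt this⟩
  rcases le_total ‖z₂‖ ‖z₁‖ with h12 | h12
  · have hz1 : z₁ ≠ 0 := by
      rintro rfl
      rw [norm_zero, norm_le_zero_iff] at h12
      exact hz0 (by simp [h12])
    refine Or.inl ⟨(z₁, z₂ / z₁), ⟨hNs 0 ⟨?_, ?_⟩, hz1⟩, ?_⟩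
    · simpa using hz'.1.trans_le (min_le_left _ _)
    · simpa using div_le_one_of_le₀ h12 (norm_nonneg _)
    · ext <;> simp [blowDown, direction]
      field_simp
  · have hz2 : z₂ ≠ 0 := by
      rintro rfl
      rw [norm_zero, norm_le_zero_iff] at h12
      exact hz0 (by simp [h12])
    refine Or.inr ⟨(z₂, z₁ / z₂), ⟨hNs 1 ⟨?_, ?_⟩, hz2⟩, ?_⟩
    · simpa using hz'.2.trans_le (min_le_right _ _)
    · simpa using div_le_one_of_le₀ h12 (norm_nonneg _)
    · ext <;> simp [blowDown, direction]
      field_simp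

/-- A potential of `T` whose pull-backs are potentials of `π^*T` is in `W^{1,2}` near every
point. -/
lemma exists_isW12On_of_pullback {B : TopologicalSpace.Opens C2} {S R : BlowUpCurrent B} {ν : ℝ}
    (hR : ∀ i α, R.inChart i α = S.inChart i α - (ν : ℂ) * integrationE B i α)
    (hW : R.HasPshPotentialsW12Loc) {V : Set C2} (hV : IsOpen V) (hVB : V ⊆ B) {u : C2 → EReal}
    (hS : ∀ i, IsPshPotential (S.inChart i) {q | (chart i q).1 ∈ V} fun q => u (chart i q).1)
    {p : C2} (hp : p ∈ V) :
    ∃ U : Set C2, IsOpen U ∧ p ∈ U ∧ IsW12On (fun z => (u z).toReal) U := by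
  have key : ∀ (i : Fin 2) (q : C2), blowDown i q ∈ V → ∃ N : Set C2, IsOpen N ∧ q ∈ N ∧
      IsW12On (fun z => (u z).toReal) (blowDown i '' (N ∩ {q | q.1 ≠ 0})) := fun i q hq =>
    exists_isW12On_image_of_potential (hR i) (hW i) hV (hS i)
      ((chart_mem_blowUp_iff B i q).2 (hVB hq)) hq
  by_cases hp0 : p = 0
  · subst hp0
    exact exists_isW12On_zero fun i t => key i (0, t) (by simpa [blowDown] using hp)
  · obtain ⟨i, hi⟩ : ∃ i, coord i p ≠ 0 := by
      by_contra! h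
      exact hp0 (Prod.ext (by simpa [coord] using h 0) (by simpa [coord] using h 1))
    have hpi := blowDown_blowDownInv i hi
    obtain ⟨N, hN, hpN, hNW⟩ := key i (blowDownInv i p) (by rwa [hpi])
    have hopen : IsOpen {q : C2 | q.1 ≠ 0} := isOpen_ne_fun continuous_fst continuous_const
    exact ⟨_, isOpen_image_blowDown i (hN.inter hopen) fun q hq => hq.2,
      ⟨_, ⟨hpN, hi⟩, hpi⟩, hNW⟩

end BlowDown

end

theorem proposition4p5 (c : BlowDown.C2) (r : ℝ) (h0 : (0 : BlowDown.C2) ∈ BlowDown.euclBall c r)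
    (T : BlowDown.Current (BlowDown.euclBall c r))
    (hpos : BlowDown.IsPositive T) (hclosed : BlowDown.IsClosedCurrent T)
    (S R : BlowDown.BlowUpCurrent (BlowDown.euclBall c r))
    (hS : BlowDown.IsPullback T S)
    (hR : ∀ (i : Fin 2) (α : BlowDown.TestForm (BlowDown.chartDomain (BlowDown.euclBall c r) i)),
      R.inChart i α = S.inChart i α -
        (BlowDown.lelongNumber T 0 : ℂ) * BlowDown.integrationE (BlowDown.euclBall c r) i α)
    (hW : R.HasPshPotentialsW12Loc) :
    BlowDown.HasPshPotentialsW12Loc T ∧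
    ∀ (V : Set BlowDown.C2) (u : BlowDown.C2 → EReal), IsOpen V →
      V ⊆ BlowDown.euclBall c r → BlowDown.IsPshPotential T V u →
      BlowDown.IsW12Loc (fun z => (u z).toReal) V := by
  have key : ∀ (V : Set BlowDown.C2) (u : BlowDown.C2 → EReal), IsOpen V →
      V ⊆ BlowDown.euclBall c r → BlowDown.IsPshPotential T V u →
      BlowDown.IsW12Loc (fun z => (u z).toReal) V := by
    intro V u hV hVB hu
    refine BlowDown.isW12Loc_of_forall_exists fun p hp => ?_
    obtain ⟨V₀, hV₀, hpV₀, hV₀B, u₀, hu₀, hSu₀⟩ := hS p (hVB hp)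
    obtain ⟨W, hWo, hpW, g, hg, hgW⟩ := hu.exists_ae_eq_add hV hV₀ hVB hu₀ hp hpV₀
    obtain ⟨U, hU, hpU, hu₀U⟩ := BlowDown.exists_isW12On_of_pullback hR hW hV₀ hV₀B hSu₀ hpV₀
    -- `u` differs from the potential `u₀`, whose pull-back is known, by the smooth function `g`
    have hM : IsOpen (U ∩ W ∩ Metric.ball p 1) := (hU.inter hWo).inter Metric.isOpen_ball
    have hMW : U ∩ W ∩ Metric.ball p 1 ⊆ W := fun z hz => hz.1.2
    refine ⟨_, hM, ⟨⟨hpU, hpW⟩, Metric.mem_ball_self one_pos⟩, ?_⟩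
    obtain ⟨G, hG⟩ := (hu₀U.mono fun z hz => hz.1.1).add
      (BlowDown.isW12On_of_contDiff hg hM (Metric.isBounded_ball.subset Set.inter_subset_right))
    refine ⟨G, hG.congr_ae hM.measurableSet ?_ ae_eq_rfl⟩
    exact (hgW.filter_mono (ae_mono (Measure.restrict_mono hMW le_rfl))).symm
  refine ⟨fun p hp => ?_, key⟩
  obtain ⟨V, hV, hpV, hVB, u, hu, -⟩ := hS p hp
  exact ⟨V, hV, hpV, hVB, u, hu, key V u hV hVB hu⟩
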